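/- Consider the $K$-armed Gaussian bandit with horizon $T\ge 1$: in round $t\in\{1,\dots,T\}$ arm $A_t$ is chosen on the basis of the past rewards $R_1,\dots,R_{t-1}$ and the reward $R_t=\mu_{A_t}+\sigma\xi_t$ is observed, where $\sigma>0$ and $\xi_1,\dots,\xi_T$ are i.i.d. $\mathcal N(0,1)$. Put $\mu_*=\max_b\mu_b$, $\Delta_a=\mu_*-\mu_a$. UCB1 with exploration rate $\gamma_T=\sqrt{2\log T}$ pulls every arm once in the first $K$ rounds and then chooses $A_t\in\arg\max_a\{\hat\mu_{a;t-1}+\sigma\gamma_T/\sqrt{n_{a;t-1}}\}$ (ties and initial order arbitrary), where $n_{a;t}$ is the number of pulls of arm $a$ in the first $t$ rounds and $\hat\mu_{a;t}$ the empirical mean of the rewards of those pulls. Let $R=\mathbb E\sum_{t\le T}(\mu_*-R_t)$ be its expected regret and $R^{\mathsf{LR}}=2\log T\sum_{a:\Delta_a>0}\sigma^2/\Delta_a$. For $\eta,L>0$ let $\mathscr C_\eta(L)$ be the set of all $\Delta\in\mathbb R_{\ge0}^K$, $\Delta\ne0$, with at least one zero entry, such that $$L\sqrt{K\log T/T}\le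 \Delta_a/\sigma\le \eta\sqrt{\log T}\qquad\text{whenever }\Delta_a>0 .$$ There is a universal constant $C>0$ such that, whenever $K/T\le 1/C$, the following hold for all $\sigma>0$ and $\eta>0$. 1. If $\eta\le1$, then for every $L>C$, with $\epsilon_{T,K}=\sqrt{\log\log T/\log T}+K/T$, $$\sup_{\Delta\in\mathscr C_\eta(L)}\left|\frac{R}{R^{\mathsf{LR}}}-1\right|\le C\left(\frac1L+\epsilon_{T,K}+\eta\right).$$ 2. If $K\ge2$, then for every $\epsilon\in(0,1/2)$ with $\epsilon\sqrt{K/T}\le\eta$ (so that $\mathscr C_\eta(\epsilon)\neq\emptyset$), there is $\Delta\in\mathscr C_\eta(\epsilon)$ with $R/R^{\mathsf{LR}}\le C\epsilon^2$; in particular $\inf_{\Delta\in\mathscr C_\eta(\epsilon)}R/R^{\mathsf{LR}}\le C\epsilon^2$. 3. Consequently, the Lai–Robbins formula is uniformly exact if and only if the positive gaps are $\gg\sigma\sqrt{K\log T/T}$: for any sequences $T_n\to\infty$, $K_n\ge2$ with $K_n/T_n\to0$, $\sigma_n>0$, $\eta_n\to0$ and $L_n>0$ with $L_n\sqrt{K_n/T_n}\le\eta_n$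 (so that the class $\mathscr C_{\eta_n}(L_n)$ formed with $T_n,K_n,\sigma_n$ is non-empty once $T_n\ge2$), one has $$\sup_{\Delta\in\mathscr C_{\eta_n}(L_n)}\left|\frac{R}{R^{\mathsf{LR}}}-1\right|\to0\quad\Longleftrightarrow\quad L_n\to\infty .$$ -/

import Mathlib

open MeasureTheory ProbabilityTheory

universe u

noncomputable section

namespace Bandit

/-- Optimal mean reward `μ_* = max_b μ_b`. -/
def optMean {K : ℕ} (μ : Fin K → ℝ) : ℝ := ⨆ b, μ b

/-- Sub-optimality gaps `Δ_a = μ_* - μ_a`. -/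
def gap {K : ℕ} (μ : Fin K → ℝ) (a : Fin K) : ℝ := optMean μ - μ a

section Rounds

variable {Ω : Type u} {T K : ℕ}

/-- Reward of round `t`: `R_t = μ_{A_t} + σ ξ_t`. -/
def reward (μ : Fin K → ℝ) (σ : ℝ) (ξ : Fin T → Ω → ℝ) (A : Fin T → Ω → Fin K)
    (t : Fin T) (ω : Ω) : ℝ :=
  μ (A t ω) + σ * ξ t ω

/-- The rounds strictly before round `t` in which arm `a` was pulled. -/
def pullsBefore (A : Fin T → Ω → Fin K) (a : Fin K) (t : Fin T) (ω : Ω) : Finset (Fin T) :=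
  (Finset.Iio t).filter (fun s => A s ω = a)

/-- Number of pulls of arm `a` strictly before round `t`. -/
def numPulls (A : Fin T → Ω → Fin K) (a : Fin K) (t : Fin T) (ω : Ω) : ℕ :=
  (pullsBefore A a t ω).card

/-- Empirical mean of the rewards of arm `a` strictly before round `t`. -/
def empMean (μ : Fin K → ℝ) (σ : ℝ) (ξ : Fin T → Ω → ℝ) (A : Fin T → Ω → Fin K)
    (a : Fin K) (t : Fin T) (ω : Ω) : ℝ :=
  (∑ s ∈ pullsBefore A a t ω, reward μ σ ξ A s ω) / (numPulls A a t ω : ℝ)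

/-- The index (over-estimated mean) which UCB1 with exploration rate `γ` maximizes in round `t`. -/
def ucbIndex (μ : Fin K → ℝ) (σ γ : ℝ) (ξ : Fin T → Ω → ℝ) (A : Fin T → Ω → Fin K)
    (a : Fin K) (t : Fin T) (ω : Ω) : ℝ :=
  empMean μ σ ξ A a t ω + σ * γ / √(numPulls A a t ω : ℝ)

/-- The σ-algebra generated by the rewards observed strictly before round `t`. -/
abbrev pastRewards (μ : Fin K → ℝ) (σ : ℝ) (ξ : Fin T → Ω → ℝ) (A : Fin T → Ω → Fin K)
    (t : Fin T) : MeasurableSpace Ω :=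
  ⨆ s ∈ Set.Iio t, MeasurableSpace.comap (reward μ σ ξ A s) inferInstance

end Rounds

/-- A run of UCB1 with exploration rate `γ` over `T` rounds of the `K`-armed Gaussian bandit with
mean vector `μ` and noise level `σ`. Rounds are numbered `0, …, T - 1`; the order of the initial
pulls and the way of breaking ties are arbitrary, as long as every arm is chosen on the basis of
past rewards only. -/
structure UCB1Run (T K : ℕ) (μ : Fin K → ℝ) (σ γ : ℝ) where
  /-- the probability space -/
  Ω : Type u
  mΩ : MeasurableSpace Ω
  P : Measure Ω
  isProb : IsProbabilityMeasure P
  /-- the noises, i.i.d. standard Gaussian -/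
  ξ : Fin T → Ω → ℝ
  ξ_meas : ∀ t, Measurable (ξ t)
  ξ_indep : iIndepFun ξ P
  ξ_law : ∀ t, P.map (ξ t) = gaussianReal 0 1
  /-- the arms that are pulled -/
  A : Fin T → Ω → Fin K
  A_adapted : ∀ t, Measurable[pastRewards μ σ ξ A t] (A t)
  /-- in the first `K` rounds each arm is pulled once -/
  A_init : ∀ ω, Set.InjOn (fun t => A t ω) {t : Fin T | (t : ℕ) < K}
  /-- afterwards the arm maximizes the index -/
  A_step : ∀ t : Fin T, K ≤ (t : ℕ) → ∀ ω, ∀ b : Fin K,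
    ucbIndex μ σ γ ξ A b t ω ≤ ucbIndex μ σ γ ξ A (A t ω) t ω

/-- Expected regret `E ∑_t (μ_* - R_t)`. -/
def UCB1Run.regret {T K : ℕ} {μ : Fin K → ℝ} {σ γ : ℝ} (X : UCB1Run.{u} T K μ σ γ) : ℝ :=
  letI := X.mΩ
  ∫ ω, ∑ t : Fin T, (optMean μ - reward μ σ X.ξ X.A t ω) ∂X.P

/-- The Lai–Robbins value `2 log T · ∑_{a : Δ_a > 0} σ² / Δ_a`. -/
def laiRobbins (T : ℕ) {K : ℕ} (σ : ℝ) (Δ : Fin K → ℝ) : ℝ :=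
  2 * Real.log T * ∑ a with 0 < Δ a, σ ^ 2 / Δ a

/-- The gap vectors, not identically zero but with at least one vanishing entry, whose positive
entries satisfy `L √(K log T / T) ≤ Δ_a / σ ≤ η √(log T)`. -/
def gapClass (T K : ℕ) (σ η L : ℝ) : Set (Fin K → ℝ) :=
  {Δ | (∀ a, 0 ≤ Δ a) ∧ Function.support Δ ⊂ Set.univ ∧ Δ ≠ 0 ∧
    ∀ a, 0 < Δ a →
      Δ a / σ ∈ Set.Icc (L * √(K * Real.log T / T)) (η * √(Real.log T))}

/-- `sup_{Δ ∈ gapClass} |R / R^LR - 1| ≤ δ`, for UCB1 with exploration rate `√(2 log T)`. -/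
def LaiRobbinsWithin (T K : ℕ) (σ η L δ : ℝ) : Prop :=
  ∀ Δ ∈ gapClass T K σ η L, ∀ μ : Fin K → ℝ, gap μ = Δ →
    ∀ X : UCB1Run.{u} T K μ σ (√(2 * Real.log T)),
      |X.regret / laiRobbins T σ Δ - 1| ≤ δ

end Bandit

end

/-! Write $\gamma^2=2\log T$ and $d_a=\Delta_a/\sigma$. The noise is centred, so
$R=\sum_a\Delta_a\,\mathbb E n_{a;T}$, while $R^{\mathsf{LR}}=\sum_a\Delta_a\gamma^2/d_a^2$. Bounds
on $R/R^{\mathsf{LR}}$ thus follow arm by arm from comparing $\mathbb E n_{a;T}$ with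
$\gamma^2/d_a^2$ (`le_ratio`, `ratio_le`).

Upper bound (`integral_count_le`). Pulling a suboptimal arm means that its index beats that of an
optimal arm. The event that the optimal index ever falls below $\mu_*-\delta\Delta_a$ has
probability $O(1/T)$, since $e^{-\gamma^2/2}=1/T$, so it may be charged the trivial count $T$. Off
this event, the $n$-th sample mean of the arm must exceed its mean by about
$\Delta_a-\sigma\gamma/\sqrt n$, which is unlikely once $n$ is slightly larger than
$\gamma^2/d_a^2$. The tolerance $\delta$ is `accuracy`, of order $\sqrt{\log\log T/\log T}$.

Lower bound (`count_ge`, `le_integral_count`). If all positive gaps are at least $L\sigma\sqrt{K\log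
T/T}$, the upper bound leaves $O(K+T/L^2)$ expected pulls to the suboptimal arms. Typically, then,
some optimal arm has more than $T/(2K)$ pulls, and at its last one its index is at most
$\mu_*+O(\Delta_a/L)$. The index of arm $a$ was no larger at that moment, which forces about
$\gamma^2/d_a^2$ pulls of $a$.

Small gaps. The regret never exceeds $T\max_a\Delta_a$, whereas $R^{\mathsf{LR}}$ grows like
$1/\Delta$. With one optimal arm and all other gaps minimal, the ratio is at most $\epsilon^2$
(`exists_small_ratio`). This says nothing for bounded $L\ge1$, so the converse in the third claim
uses the opposite configuration: one suboptimal arm and $K-1$ optimal ones. The optimal arms share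
the rounds, so one of them has at most $2T/(K-1)$ pulls and keeps an exploration bonus comparable to
$\Delta_a/L$. Arm $a$ then faces the enlarged gap $\Delta_a(1+1/(3L))$, and the ratio stays below
$(1+1/(3L))^{-2}+o(1)$ (`integral_count_le_of_many_optimal`).

All probabilities rest on one maximal inequality for the adaptively sampled noise of an arm,
`prob_exists_sumNoise_ge`, obtained from an exponential martingale. -/

noncomputable section

/-! ### Pull counts, accumulated noise and the maximal inequality. -/

namespace Bandit

attribute [local instance] UCB1Run.mΩ UCB1Run.isProb

namespace UCB1Run

variable {T K : ℕ} {μ : Fin K → ℝ} {σ γ : ℝ} (X : UCB1Run.{u} T K μ σ γ)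

/-- The rounds before time `t` in which arm `a` is pulled. -/
def pulls (a : Fin K) (t : ℕ) (ω : X.Ω) : Finset (Fin T) :=
  Finset.univ.filter fun s => (s : ℕ) < t ∧ X.A s ω = a

/-- The number of pulls of arm `a` before time `t`. -/
def count (a : Fin K) (t : ℕ) (ω : X.Ω) : ℕ := (X.pulls a t ω).card

/-- The total noise in the rewards of arm `a` before time `t`. -/
def noise (a : Fin K) (t : ℕ) (ω : X.Ω) : ℝ := ∑ s ∈ X.pulls a t ω, X.ξ s ω

/-- The σ-algebra of the noises before time `t`. -/
abbrev past (t : ℕ) : MeasurableSpace X.Ω :=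
  ⨆ s ∈ {s : Fin T | (s : ℕ) < t}, MeasurableSpace.comap (X.ξ s) inferInstance

theorem past_le (t : ℕ) : X.past t ≤ X.mΩ :=
  iSup₂_le fun s _ => (X.ξ_meas s).comap_le

theorem past_mono {s t : ℕ} (h : s ≤ t) : X.past s ≤ X.past t :=
  biSup_mono fun _ hr => lt_of_lt_of_le hr h

theorem measurable_noise_past {s : Fin T} {t : ℕ} (h : (s : ℕ) < t) :
    Measurable[X.past t] (X.ξ s) :=
  (comap_measurable (X.ξ s)).mono
    (le_iSup₂_of_le (f := fun (s : Fin T) (_ : s ∈ {s : Fin T | (s : ℕ) < t}) =>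
      MeasurableSpace.comap (X.ξ s) inferInstance) s h le_rfl) le_rfl

/-- Adaptedness is given with respect to rewards, but independence is available for noises. Each
past reward is a function of a past arm and a past noise, so strong induction on the round passes
from one filtration to the other. -/
theorem measurable_arm_past (t : Fin T) : Measurable[X.past t] (X.A t) := by
  obtain ⟨n, hn⟩ := t
  induction n using Nat.strong_induction_on with
  | _ n ih =>
    refine (X.A_adapted ⟨n, hn⟩).mono ?_ le_rfl
    refine iSup₂_le fun s hs => ?_
    have hs' : (s : ℕ) < n := hs
    have h1 : Measurable[X.past n] (X.A s) :=
      (ih s hs' s.2).mono (X.past_mono hs'.le) le_rfl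
    have h2 : Measurable[X.past n] (X.ξ s) := X.measurable_noise_past hs'
    have h3 : Measurable[X.past n] (reward μ σ X.ξ X.A s) :=
      Measurable.add ((measurable_of_finite μ).comp h1) (h2.const_mul σ)
    exact h3.comap_le

theorem measurable_arm_past_of_lt {s : Fin T} {t : ℕ} (h : (s : ℕ) ≤ t) :
    Measurable[X.past t] (X.A s) :=
  (X.measurable_arm_past s).mono (X.past_mono h) le_rfl

theorem count_eq_sum (a : Fin K) (t : ℕ) (ω : X.Ω) :
    X.count a t ω = ∑ s : Fin T, if (s : ℕ) < t ∧ X.A s ω = a then 1 else 0 := by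
  simp [count, pulls]

theorem noise_eq_sum (a : Fin K) (t : ℕ) (ω : X.Ω) :
    X.noise a t ω = ∑ s : Fin T, if (s : ℕ) < t ∧ X.A s ω = a then X.ξ s ω else 0 := by
  simp [noise, pulls, Finset.sum_filter]

theorem measurable_count_past (a : Fin K) (t : ℕ) : Measurable[X.past t] (X.count a t) := by
  have h : X.count a t = fun ω => ∑ s : Fin T, if (s : ℕ) < t ∧ X.A s ω = a then 1 else 0 :=
    funext fun ω => X.count_eq_sum a t ω
  rw [h]
  refine Finset.measurable_fun_sum _ fun s _ => ?_
  by_cases hs : (s : ℕ) < t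
  · simp only [hs, true_and]
    refine Measurable.ite ?_ measurable_const measurable_const
    exact (X.measurable_arm_past_of_lt hs.le) (measurableSet_singleton a)
  · simp only [hs, false_and, if_false]
    exact measurable_const

theorem measurable_sumNoise_past (a : Fin K) (t : ℕ) : Measurable[X.past t] (X.noise a t) := by
  have h : X.noise a t =
      fun ω => ∑ s : Fin T, if (s : ℕ) < t ∧ X.A s ω = a then X.ξ s ω else 0 :=
    funext fun ω => X.noise_eq_sum a t ω
  rw [h]
  refine Finset.measurable_fun_sum _ fun s _ => ?_
  by_cases hs : (s : ℕ) < t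
  · simp only [hs, true_and]
    refine Measurable.ite ?_ (X.measurable_noise_past hs) measurable_const
    exact (X.measurable_arm_past_of_lt hs.le) (measurableSet_singleton a)
  · simp only [hs, false_and, if_false]
    exact measurable_const

theorem measurable_count (a : Fin K) (t : ℕ) : Measurable (X.count a t) :=
  (X.measurable_count_past a t).mono (X.past_le t) le_rfl

theorem measurable_sumNoise (a : Fin K) (t : ℕ) : Measurable (X.noise a t) :=
  (X.measurable_sumNoise_past a t).mono (X.past_le t) le_rfl

theorem pulls_zero (a : Fin K) (ω : X.Ω) : X.pulls a 0 ω = ∅ := by simp [pulls]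

theorem pulls_succ_of_eq {a : Fin K} {t : Fin T} {ω : X.Ω} (h : X.A t ω = a) :
    X.pulls a (t + 1) ω = insert t (X.pulls a t ω) := by
  ext s
  simp only [pulls, Finset.mem_filter, Finset.mem_univ, true_and, Finset.mem_insert]
  constructor
  · rintro ⟨h1, h2⟩
    rcases (Nat.lt_succ_iff_lt_or_eq.mp h1) with h3 | h3
    · exact Or.inr ⟨h3, h2⟩
    · exact Or.inl (Fin.ext h3)
  · rintro (rfl | ⟨h1, h2⟩)
    · exact ⟨Nat.lt_succ_self _, h⟩
    · exact ⟨Nat.lt_succ_of_lt h1, h2⟩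

theorem pulls_succ_of_ne {a : Fin K} {t : Fin T} {ω : X.Ω} (h : X.A t ω ≠ a) :
    X.pulls a (t + 1) ω = X.pulls a t ω := by
  ext s
  simp only [pulls, Finset.mem_filter, Finset.mem_univ, true_and]
  constructor
  · rintro ⟨h1, h2⟩
    rcases (Nat.lt_succ_iff_lt_or_eq.mp h1) with h3 | h3
    · exact ⟨h3, h2⟩
    · exact absurd (by rw [← h2, Fin.ext h3]) h
  · rintro ⟨h1, h2⟩
    exact ⟨Nat.lt_succ_of_lt h1, h2⟩

theorem not_mem_pulls (a : Fin K) (t : Fin T) (ω : X.Ω) : t ∉ X.pulls a t ω := by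
  simp [pulls]

theorem count_succ_of_eq {a : Fin K} {t : Fin T} {ω : X.Ω} (h : X.A t ω = a) :
    X.count a (t + 1) ω = X.count a t ω + 1 := by
  rw [count, X.pulls_succ_of_eq h, Finset.card_insert_of_notMem (X.not_mem_pulls a t ω), count]

theorem count_succ_of_ne {a : Fin K} {t : Fin T} {ω : X.Ω} (h : X.A t ω ≠ a) :
    X.count a (t + 1) ω = X.count a t ω := by
  rw [count, X.pulls_succ_of_ne h, count]

theorem sumNoise_succ_of_eq {a : Fin K} {t : Fin T} {ω : X.Ω} (h : X.A t ω = a) :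
    X.noise a (t + 1) ω = X.ξ t ω + X.noise a t ω := by
  rw [noise, X.pulls_succ_of_eq h, Finset.sum_insert (X.not_mem_pulls a t ω), noise]

theorem sumNoise_succ_of_ne {a : Fin K} {t : Fin T} {ω : X.Ω} (h : X.A t ω ≠ a) :
    X.noise a (t + 1) ω = X.noise a t ω := by
  rw [noise, X.pulls_succ_of_ne h, noise]

theorem count_mono (a : Fin K) (ω : X.Ω) : Monotone fun t => X.count a t ω := by
  intro s t h
  refine Finset.card_le_card fun r hr => ?_
  simp only [pulls, Finset.mem_filter, Finset.mem_univ, true_and] at hr ⊢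
  exact ⟨hr.1.trans_le h, hr.2⟩

theorem count_le (a : Fin K) (t : ℕ) (ω : X.Ω) : X.count a t ω ≤ T :=
  (Finset.card_le_univ (X.pulls a t ω)).trans_eq (Fintype.card_fin T)

/-- The exponential martingale of the noise of arm `a`, frozen once it reaches `c`. -/
def frozenExp (a : Fin K) (lam c : ℝ) : ℕ → X.Ω → ℝ
  | 0, _ => 1
  | t + 1, ω =>
    if h : t < T then
      frozenExp a lam c t ω *
        (if X.A ⟨t, h⟩ ω = a ∧ frozenExp a lam c t ω < c then
          Real.exp (lam * X.ξ ⟨t, h⟩ ω - lam ^ 2 / 2) else 1)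
    else frozenExp a lam c t ω

theorem frozenExp_nonneg (a : Fin K) (lam c : ℝ) (t : ℕ) (ω : X.Ω) :
    0 ≤ X.frozenExp a lam c t ω := by
  induction t with
  | zero => simp [frozenExp]
  | succ t ih =>
    rw [frozenExp]
    split_ifs
    · exact mul_nonneg ih (Real.exp_nonneg _)
    · simpa using ih
    · exact ih

theorem measurableSet_step (a : Fin K) (lam c : ℝ) (t : Fin T)
    (ih : Measurable[X.past t] (X.frozenExp a lam c t)) :
    MeasurableSet[X.past t] {ω | X.A t ω = a ∧ X.frozenExp a lam c t ω < c} := by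
  refine MeasurableSet.inter ?_ ?_
  · exact X.measurable_arm_past t (measurableSet_singleton a)
  · exact ih measurableSet_Iio

theorem measurable_frozenExp_past (a : Fin K) (lam c : ℝ) (t : ℕ) :
    Measurable[X.past t] (X.frozenExp a lam c t) := by
  induction t with
  | zero => exact measurable_const
  | succ t ih =>
    have ih' : Measurable[X.past (t + 1)] (X.frozenExp a lam c t) :=
      ih.mono (X.past_mono t.le_succ) le_rfl
    by_cases h : t < T
    · have he : X.frozenExp a lam c (t + 1) = fun ω => X.frozenExp a lam c t ω *
          (if X.A ⟨t, h⟩ ω = a ∧ X.frozenExp a lam c t ω < c then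
            Real.exp (lam * X.ξ ⟨t, h⟩ ω - lam ^ 2 / 2) else 1) := by
        funext ω; rw [frozenExp, dif_pos h]
      rw [he]
      refine Measurable.mul ih' (Measurable.ite ?_ ?_ measurable_const)
      · exact X.past_mono t.le_succ _ (X.measurableSet_step a lam c ⟨t, h⟩ ih)
      · exact Real.measurable_exp.comp
          (((X.measurable_noise_past (s := ⟨t, h⟩) (Nat.lt_succ_self t)).const_mul lam).sub
            measurable_const)
    · have he : X.frozenExp a lam c (t + 1) = X.frozenExp a lam c t := by
        funext ω; rw [frozenExp, dif_neg h]
      rw [he]; exact ih'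

theorem lintegral_exp_noise (lam : ℝ) (t : Fin T) :
    ∫⁻ ω, ENNReal.ofReal (Real.exp (lam * X.ξ t ω - lam ^ 2 / 2)) ∂X.P = 1 := by
  have hmgf := mgf_gaussianReal (X.ξ_law t) lam
  have hint : Integrable (fun ω => Real.exp (lam * X.ξ t ω)) X.P := by
    have := integrable_exp_mul_gaussianReal (μ := 0) (v := 1) lam
    rw [← X.ξ_law t] at this
    exact this.comp_measurable (X.ξ_meas t)
  rw [← ofReal_integral_eq_lintegral_ofReal]
  · simp_rw [Real.exp_sub]
    rw [integral_div]
    have : ∫ ω, Real.exp (lam * X.ξ t ω) ∂X.P = Real.exp (lam ^ 2 / 2) := by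
      simpa [mgf] using hmgf
    rw [this, div_self (Real.exp_pos _).ne', ENNReal.ofReal_one]
  · simp_rw [Real.exp_sub]
    exact hint.div_const _
  · exact Filter.Eventually.of_forall fun ω => (Real.exp_pos _).le

theorem indep_past (t : Fin T) :
    Indep (X.past t) (MeasurableSpace.comap (X.ξ t) inferInstance) X.P := by
  have h := indep_iSup_of_disjoint (fun s => (X.ξ_meas s).comap_le) X.ξ_indep.iIndep
    (S := {s : Fin T | (s : ℕ) < t}) (T := {t}) (by simp)
  rwa [iSup_singleton] at h

/-- The decision whether to multiply by the next factor depends only on the past. The factor is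
independent of the past and has mean one, so freezing does not change the expectation. -/
theorem lintegral_frozenExp (a : Fin K) (lam c : ℝ) (t : ℕ) :
    ∫⁻ ω, ENNReal.ofReal (X.frozenExp a lam c t ω) ∂X.P = 1 := by
  induction t with
  | zero => simp [frozenExp]
  | succ t ih =>
    by_cases h : t < T
    · set G : Set X.Ω := {ω | X.A ⟨t, h⟩ ω = a ∧ X.frozenExp a lam c t ω < c} with hG
      have hm := X.measurable_frozenExp_past a lam c t
      have hGm : MeasurableSet[X.past t] G := X.measurableSet_step a lam c ⟨t, h⟩ hm
      set f : X.Ω → ENNReal := fun ω => ENNReal.ofReal (X.frozenExp a lam c t ω) with hf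
      have hfm : Measurable[X.past t] f := ENNReal.measurable_ofReal.comp hm
      set Z : X.Ω → ENNReal :=
        fun ω => ENNReal.ofReal (Real.exp (lam * X.ξ ⟨t, h⟩ ω - lam ^ 2 / 2)) with hZ
      have hZm : Measurable[MeasurableSpace.comap (X.ξ ⟨t, h⟩) inferInstance] Z :=
        ENNReal.measurable_ofReal.comp (Real.measurable_exp.comp
          (((comap_measurable (X.ξ ⟨t, h⟩)).const_mul lam).sub measurable_const))
      have he : ∀ ω, ENNReal.ofReal (X.frozenExp a lam c (t + 1) ω) =
          Gᶜ.indicator f ω + G.indicator f ω * Z ω := by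
        intro ω
        rw [frozenExp, dif_pos h]
        by_cases hω : ω ∈ G
        · rw [if_pos (show _ ∧ _ from hω), Set.indicator_of_notMem (by simpa using hω),
            Set.indicator_of_mem hω,
            zero_add, ENNReal.ofReal_mul (X.frozenExp_nonneg a lam c t ω)]
        · rw [if_neg (show ¬ (_ ∧ _) from hω), Set.indicator_of_mem (by simpa using hω),
            Set.indicator_of_notMem hω]
          simp [hf]
      simp_rw [he]
      have hGm' := X.past_le t _ hGm
      have hfm' : Measurable f := hfm.mono (X.past_le t) le_rfl
      have hgm : Measurable[X.past t] (G.indicator f) := hfm.indicator hGm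
      rw [lintegral_add_left (hfm'.indicator hGm'.compl),
        lintegral_mul_eq_lintegral_mul_lintegral_of_independent_measurableSpace (X.past_le t)
          (X.ξ_meas ⟨t, h⟩).comap_le (X.indep_past ⟨t, h⟩) hgm hZm,
        X.lintegral_exp_noise, mul_one, ← lintegral_add_left (hfm'.indicator hGm'.compl)]
      rw [← ih]
      refine lintegral_congr fun ω => ?_
      by_cases hω : ω ∈ G
      · rw [Set.indicator_of_notMem (by simpa using hω), Set.indicator_of_mem hω, zero_add]
      · rw [Set.indicator_of_mem (by simpa using hω), Set.indicator_of_notMem hω, add_zero]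
    · simp_rw [frozenExp, dif_neg h]
      exact ih

/-- Once the level `c` is reached the process never moves again. A value below `c` therefore
certifies that no freezing has occurred, and the terminal value alone controls the whole path:
Markov's inequality at the end replaces a stopping argument. -/
theorem frozenExp_lt (a : Fin K) (lam c : ℝ) (ω : X.Ω) (t : ℕ) (ht : t ≤ T)
    (h : X.frozenExp a lam c t ω < c) :
    X.frozenExp a lam c t ω = Real.exp (lam * X.noise a t ω - lam ^ 2 / 2 * X.count a t ω) ∧
    ∀ s ≤ t, Real.exp (lam * X.noise a s ω - lam ^ 2 / 2 * X.count a s ω) < c := by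
  induction t with
  | zero =>
    have h0 : X.frozenExp a lam c 0 ω =
        Real.exp (lam * X.noise a 0 ω - lam ^ 2 / 2 * X.count a 0 ω) := by
      simp [frozenExp, noise, count, pulls_zero]
    refine ⟨h0, fun s hs => ?_⟩
    obtain rfl : s = 0 := by omega
    rw [← h0]; exact h
  | succ t ih =>
    have hT : t < T := ht
    have hrec : X.frozenExp a lam c (t + 1) ω = X.frozenExp a lam c t ω *
        (if X.A ⟨t, hT⟩ ω = a ∧ X.frozenExp a lam c t ω < c then
          Real.exp (lam * X.ξ ⟨t, hT⟩ ω - lam ^ 2 / 2) else 1) := by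
      rw [frozenExp, dif_pos hT]
    have hlt : X.frozenExp a lam c t ω < c := by
      by_contra hge
      rw [hrec, if_neg (fun hh => hge hh.2), mul_one] at h
      exact hge h
    obtain ⟨h1, h2⟩ := ih hT.le hlt
    have key : X.frozenExp a lam c (t + 1) ω =
        Real.exp (lam * X.noise a (t + 1) ω - lam ^ 2 / 2 * X.count a (t + 1) ω) := by
      rw [hrec]
      by_cases hA : X.A ⟨t, hT⟩ ω = a
      · have e1 := X.sumNoise_succ_of_eq hA
        have e2 := X.count_succ_of_eq hA
        simp only at e1 e2
        rw [if_pos ⟨hA, hlt⟩, h1, ← Real.exp_add, e1, e2]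
        congr 1; push_cast; ring
      · have e1 := X.sumNoise_succ_of_ne hA
        have e2 := X.count_succ_of_ne hA
        simp only at e1 e2
        rw [if_neg (fun hh => hA hh.1), h1, e1, e2, mul_one]
    refine ⟨key, fun s hs => ?_⟩
    rcases Nat.le_succ_iff.mp hs with hs | rfl
    · exact h2 s hs
    · rw [← key]; exact h

/-- Maximal inequality for the noise of one arm. -/
theorem prob_exists_sumNoise_ge (a : Fin K) {s : ℝ} (hs : s ^ 2 = 1) {M x : ℝ} (hM : 0 < M)
    (hx : 0 ≤ x) :
    X.P.real {ω | ∃ t ≤ T, (X.count a t ω : ℝ) ≤ M ∧ x ≤ s * X.noise a t ω} ≤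
      Real.exp (-(x ^ 2 / (2 * M))) := by
  -- This choice maximizes $\lambda s x-\lambda^2M/2$, with value $x^2/(2M)$. The sign $s=\pm1$
  -- treats both tails at once.
  set lam : ℝ := s * x / M with hlam
  set c : ℝ := Real.exp (x ^ 2 / (2 * M)) with hc
  have hsub : {ω | ∃ t ≤ T, (X.count a t ω : ℝ) ≤ M ∧ x ≤ s * X.noise a t ω} ⊆
      {ω | ENNReal.ofReal c ≤ ENNReal.ofReal (X.frozenExp a lam c T ω)} := by
    rintro ω ⟨t, ht, hn, hxs⟩
    refine ENNReal.ofReal_le_ofReal ?_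
    by_contra hlt
    rw [not_le] at hlt
    have h := (X.frozenExp_lt a lam c ω T le_rfl hlt).2 t ht
    rw [hc, Real.exp_lt_exp] at h
    refine absurd h (not_lt.mpr ?_)
    have hl2 : lam ^ 2 = x ^ 2 / M ^ 2 := by
      rw [hlam, div_pow, mul_pow, hs, one_mul]
    have h1 : x ^ 2 / M ≤ lam * X.noise a t ω := by
      have : lam * X.noise a t ω = x / M * (s * X.noise a t ω) := by rw [hlam]; ring
      rw [this]
      calc x ^ 2 / M = x / M * x := by ring
        _ ≤ _ := mul_le_mul_of_nonneg_left hxs (div_nonneg hx hM.le)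
    have h2 : lam ^ 2 / 2 * X.count a t ω ≤ x ^ 2 / (2 * M) := by
      calc lam ^ 2 / 2 * X.count a t ω ≤ lam ^ 2 / 2 * M :=
            mul_le_mul_of_nonneg_left hn (by positivity)
        _ = x ^ 2 / (2 * M) := by rw [hl2]; field_simp
    have h3 : x ^ 2 / M = 2 * (x ^ 2 / (2 * M)) := by field_simp
    linarith
  have hcpos : 0 < c := Real.exp_pos _
  have hm : Measurable fun ω => ENNReal.ofReal (X.frozenExp a lam c T ω) :=
    ENNReal.measurable_ofReal.comp
      ((X.measurable_frozenExp_past a lam c T).mono (X.past_le T) le_rfl)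
  have hmk := meas_ge_le_lintegral_div (μ := X.P) hm.aemeasurable
    (ε := ENNReal.ofReal c) (by simpa using hcpos) ENNReal.ofReal_ne_top
  rw [X.lintegral_frozenExp] at hmk
  have hfin : X.P {ω | ∃ t ≤ T, (X.count a t ω : ℝ) ≤ M ∧ x ≤ s * X.noise a t ω} ≤
      ENNReal.ofReal (Real.exp (-(x ^ 2 / (2 * M)))) := by
    refine (measure_mono hsub).trans (hmk.trans (le_of_eq ?_))
    rw [one_div, ← ENNReal.ofReal_inv_of_pos hcpos, hc, Real.exp_neg]
  exact ENNReal.toReal_le_of_le_ofReal (Real.exp_pos _).le hfin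

end UCB1Run
end Bandit

/-! ### Boundary crossing probabilities, indices and the regret decomposition. -/

namespace Bandit

theorem sum_Ico_le_of_telescope {f F : ℕ → ℝ} (hF : ∀ n, 0 ≤ F n)
    (h : ∀ n, f (n + 1) ≤ F n - F (n + 1)) (T : ℕ) : ∑ n ∈ Finset.Ico 1 (T + 1), f n ≤ F 0 := by
  rw [Finset.sum_Ico_eq_sum_range]
  calc ∑ n ∈ Finset.range (T + 1 - 1), f (1 + n)
      ≤ ∑ n ∈ Finset.range (T + 1 - 1), (F n - F (n + 1)) :=
        Finset.sum_le_sum fun n _ => by rw [add_comm]; exact h n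
    _ = F 0 - F (T + 1 - 1) := Finset.sum_range_sub' F _
    _ ≤ F 0 := by linarith [hF (T + 1 - 1)]

theorem sum_exp_neg_mul_le {c : ℝ} (hc : 0 < c) (T : ℕ) :
    ∑ n ∈ Finset.Ico 1 (T + 1), Real.exp (-(c * n)) ≤ 1 / c := by
  have h := sum_Ico_le_of_telescope (f := fun n : ℕ => Real.exp (-(c * n)))
    (F := fun n : ℕ => 1 / c * Real.exp (-(c * n))) (fun n => by positivity) (fun n => ?_) T
  · simpa using h
  · have h1 : Real.exp (-(c * n)) = Real.exp (-(c * (n + 1 : ℕ))) * Real.exp c := by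
      rw [← Real.exp_add]; congr 1; push_cast; ring
    have h2 := Real.add_one_le_exp c
    have h3 := Real.exp_pos (-(c * (n + 1 : ℕ)))
    rw [h1]
    rw [show 1 / c * (Real.exp (-(c * (n + 1 : ℕ))) * Real.exp c) -
      1 / c * Real.exp (-(c * (n + 1 : ℕ))) =
      Real.exp (-(c * (n + 1 : ℕ))) * (Real.exp c - 1) / c by ring, le_div_iff₀ hc]
    exact mul_le_mul_of_nonneg_left (by linarith) h3.le

theorem sum_exp_neg_mul_sqrt_le {c : ℝ} (hc : 0 < c) (T : ℕ) :
    ∑ n ∈ Finset.Ico 1 (T + 1), Real.exp (-(c * √(n : ℝ))) ≤ 2 / c ^ 2 := by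
  have h := sum_Ico_le_of_telescope (f := fun n : ℕ => Real.exp (-(c * √(n : ℝ))))
    -- The tail integral $\int_n^\infty e^{-c\sqrt u}\,du$ in closed form.
    (F := fun n : ℕ => 2 / c ^ 2 * ((1 + c * √(n : ℝ)) * Real.exp (-(c * √(n : ℝ)))))
    (fun n => by positivity) (fun n => ?_) T
  · simpa using h
  · set p := √(n : ℝ) with hp
    set q := √((n + 1 : ℕ) : ℝ) with hq
    have hp0 : 0 ≤ p := Real.sqrt_nonneg _
    have hp2 : p ^ 2 = n := Real.sq_sqrt (Nat.cast_nonneg n)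
    have hq2 : q ^ 2 = n + 1 := by rw [hq, Real.sq_sqrt (Nat.cast_nonneg _)]; push_cast; ring
    have hpq : p ≤ q := Real.sqrt_le_sqrt (by push_cast; linarith)
    have h1 : Real.exp (-(c * p)) = Real.exp (-(c * q)) * Real.exp (c * (q - p)) := by
      rw [← Real.exp_add]; congr 1; ring
    have h2 := Real.quadratic_le_exp_of_nonneg (x := c * (q - p))
      (mul_nonneg hc.le (by linarith))
    have h3 := Real.exp_pos (-(c * q))
    have h4 : 1 + c * q + c ^ 2 / 2 ≤ (1 + c * p) * Real.exp (c * (q - p)) := by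
      have h5 : (1 + c * p) * (1 + c * (q - p) + (c * (q - p)) ^ 2 / 2) ≤
          (1 + c * p) * Real.exp (c * (q - p)) :=
        mul_le_mul_of_nonneg_left h2 (by positivity)
      have h6 : 0 ≤ c * p * (c * (q - p)) ^ 2 := by positivity
      have h7 : (1 + c * p) * (1 + c * (q - p) + (c * (q - p)) ^ 2 / 2) =
          1 + c * q + c ^ 2 / 2 * (q ^ 2 - p ^ 2) + c * p * (c * (q - p)) ^ 2 / 2 := by ring
      rw [hq2, hp2] at h7
      nlinarith
    rw [h1, show 2 / c ^ 2 * ((1 + c * p) * (Real.exp (-(c * q)) * Real.exp (c * (q - p)))) -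
      2 / c ^ 2 * ((1 + c * q) * Real.exp (-(c * q))) = Real.exp (-(c * q)) *
        (2 * ((1 + c * p) * Real.exp (c * (q - p)) - (1 + c * q))) / c ^ 2 by ring,
      le_div_iff₀ (by positivity)]
    exact mul_le_mul_of_nonneg_left (by linarith) h3.le

attribute [local instance] UCB1Run.mΩ UCB1Run.isProb

namespace UCB1Run

variable {T K : ℕ} {μ : Fin K → ℝ} {σ γ : ℝ} (X : UCB1Run.{u} T K μ σ γ)

/-- The event that `s` times the total noise of arm `a` is at least `x` when the arm has been
pulled `n` times. -/
def reach (a : Fin K) (s : ℝ) (n : ℕ) (x : ℝ) : Set X.Ω :=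
  {ω | ∃ t ≤ T, X.count a t ω = n ∧ x ≤ s * X.noise a t ω}

/-- The event that `s` times the total noise of arm `a` crosses the boundary `f`. -/
def crossing (a : Fin K) (s : ℝ) (f : ℕ → ℝ) : Set X.Ω :=
  {ω | ∃ t ≤ T, 1 ≤ X.count a t ω ∧ f (X.count a t ω) ≤ s * X.noise a t ω}

theorem measurableSet_reach (a : Fin K) (s : ℝ) (n : ℕ) (x : ℝ) :
    MeasurableSet (X.reach a s n x) := by
  have h : X.reach a s n x =
      ⋃ t ∈ Finset.range (T + 1), {ω | X.count a t ω = n} ∩ {ω | x ≤ s * X.noise a t ω} := by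
    ext ω
    simp only [reach, Set.mem_ofPred_eq, Set.mem_iUnion, Finset.mem_range, Nat.lt_succ_iff,
      exists_prop, Set.mem_inter_iff]
  rw [h]
  refine Finset.measurableSet_biUnion _ fun t _ => MeasurableSet.inter ?_ ?_
  · exact X.measurable_count a t (measurableSet_singleton n)
  · exact ((X.measurable_sumNoise a t).const_mul s) measurableSet_Ici

theorem crossing_eq (a : Fin K) (s : ℝ) (f : ℕ → ℝ) :
    X.crossing a s f = ⋃ n ∈ Finset.Ico 1 (T + 1), X.reach a s n (f n) := by
  ext ω
  simp only [crossing, reach, Set.mem_ofPred_eq, Set.mem_iUnion, Finset.mem_Ico, exists_prop]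
  constructor
  · rintro ⟨t, ht, h1, h2⟩
    exact ⟨_, ⟨h1, Nat.lt_succ_of_le (X.count_le a t ω)⟩, t, ht, rfl, h2⟩
  · rintro ⟨n, ⟨h1, -⟩, t, ht, rfl, h2⟩
    exact ⟨t, ht, h1, h2⟩

theorem measurableSet_crossing (a : Fin K) (s : ℝ) (f : ℕ → ℝ) :
    MeasurableSet (X.crossing a s f) := by
  rw [crossing_eq]
  exact Finset.measurableSet_biUnion _ fun n _ => X.measurableSet_reach a s n _

theorem prob_reach_le (a : Fin K) {s : ℝ} (hs : s ^ 2 = 1) {n : ℕ} (hn : 0 < n) {x : ℝ}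
    (hx : 0 ≤ x) : X.P.real (X.reach a s n (√(n : ℝ) * x)) ≤ Real.exp (-(x ^ 2 / 2)) := by
  have hn' : (0 : ℝ) < n := Nat.cast_pos.mpr hn
  have h := X.prob_exists_sumNoise_ge a hs (M := n) (x := √(n : ℝ) * x) hn' (by positivity)
  refine (measureReal_mono ?_).trans (h.trans (le_of_eq ?_))
  · rintro ω ⟨t, ht, h1, h2⟩
    exact ⟨t, ht, by rw [h1], h2⟩
  · rw [mul_pow, Real.sq_sqrt hn'.le]
    congr 2
    field_simp

/-- Peeling: the self-normalized noise of an arm is rarely large. -/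
theorem prob_crossing_sqrt_le (a : Fin K) {s : ℝ} (hs : s ^ 2 = 1) {y : ℝ} (hy : 0 ≤ y) :
    X.P.real (X.crossing a s fun n => y * √(n : ℝ)) ≤
      (Nat.log 2 T + 1) * Real.exp (-(y ^ 2 / 4)) := by
  have hsub : (X.crossing a s fun n => y * √(n : ℝ)) ⊆
      ⋃ j ∈ Finset.range (Nat.log 2 T + 1), {ω | ∃ t ≤ T,
        (X.count a t ω : ℝ) ≤ 2 ^ (j + 1) ∧ y * √(2 ^ j) ≤ s * X.noise a t ω} := by
    rintro ω ⟨t, ht, h1, h2⟩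
    simp only [Set.mem_iUnion, Set.mem_ofPred_eq, Finset.mem_range, exists_prop]
    -- Dyadic block of the count. Within a block the variance varies by a factor of at most two,
    -- which turns the exponent $y^2/2$ into $y^2/4$.
    refine ⟨Nat.log 2 (X.count a t ω), ?_, t, ht, ?_, le_trans ?_ h2⟩
    · exact Nat.lt_succ_of_le (Nat.log_mono_right (X.count_le a t ω))
    · exact_mod_cast (Nat.lt_pow_succ_log_self (by norm_num) _).le
    · refine mul_le_mul_of_nonneg_left (Real.sqrt_le_sqrt ?_) hy
      exact_mod_cast Nat.pow_log_le_self 2 (by omega)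
  refine (measureReal_mono hsub (measure_ne_top _ _)).trans
    ((measureReal_biUnion_finset_le _ _).trans ?_)
  refine (Finset.sum_le_card_nsmul _ _ (Real.exp (-(y ^ 2 / 4))) fun j _ => ?_).trans
    (le_of_eq ?_)
  · refine (X.prob_exists_sumNoise_ge a hs (by positivity) (by positivity)).trans (le_of_eq ?_)
    rw [mul_pow, Real.sq_sqrt (by positivity)]
    congr 2
    field_simp
    ring
  · rw [Finset.card_range, nsmul_eq_mul]; push_cast; ring

/-- Since $(\gamma+x\sqrt n)^2/2\ge\gamma^2/2+\gamma x\sqrt n$, the linear part of the boundary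
makes the union bound over $n$ summable. The full factor $e^{-\gamma^2/2}$ survives, with no loss
from peeling. -/
theorem prob_crossing_index_le (a : Fin K) (hγ : 0 < γ) {x : ℝ} (hx : 0 < x) :
    X.P.real (X.crossing a (-1) fun n => γ * √(n : ℝ) + x * n) ≤
      Real.exp (-(γ ^ 2 / 2)) * (2 / (γ * x) ^ 2) := by
  rw [crossing_eq]
  refine (measureReal_biUnion_finset_le _ _).trans ?_
  calc ∑ n ∈ Finset.Ico 1 (T + 1), X.P.real (X.reach a (-1) n (γ * √(n : ℝ) + x * n))
      ≤ ∑ n ∈ Finset.Ico 1 (T + 1),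
          Real.exp (-(γ ^ 2 / 2)) * Real.exp (-(γ * x * √(n : ℝ))) := by
        refine Finset.sum_le_sum fun n hn => ?_
        have hn1 : 0 < n := (Finset.mem_Ico.mp hn).1
        have he : γ * √(n : ℝ) + x * n = √(n : ℝ) * (γ + x * √(n : ℝ)) := by
          have := Real.mul_self_sqrt (Nat.cast_nonneg (α := ℝ) n)
          linear_combination (-x) * this
        rw [he]
        refine (X.prob_reach_le a (by norm_num) hn1 (by positivity)).trans ?_
        rw [← Real.exp_add, Real.exp_le_exp]
        have : 0 ≤ (x * √(n : ℝ)) ^ 2 := by positivity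
        nlinarith
    _ = Real.exp (-(γ ^ 2 / 2)) *
          ∑ n ∈ Finset.Ico 1 (T + 1), Real.exp (-(γ * x * √(n : ℝ))) := by
        rw [Finset.mul_sum]
    _ ≤ _ := mul_le_mul_of_nonneg_left (sum_exp_neg_mul_sqrt_le (by positivity) T)
        (Real.exp_pos _).le

theorem sum_prob_reach_le (a : Fin K) (hγ : 0 < γ) {θ D : ℝ} (hθ : 0 < θ) (hθ1 : θ ≤ 1)
    (hD : 0 < D) :
    ∑ n ∈ Finset.Ico 1 (T + 1) with ((1 + θ) * γ / D) ^ 2 < ((n : ℕ) : ℝ),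
      X.P.real (X.reach a 1 n (D * n - γ * √(n : ℝ))) ≤
      Real.exp (-(θ ^ 2 * γ ^ 2 / 4)) * (16 / (θ ^ 2 * D ^ 2)) := by
  calc _ ≤ ∑ n ∈ Finset.Ico 1 (T + 1) with ((1 + θ) * γ / D) ^ 2 < ((n : ℕ) : ℝ),
          Real.exp (-(θ ^ 2 * γ ^ 2 / 4)) * Real.exp (-(θ ^ 2 * D ^ 2 / 16 * n)) := by
        refine Finset.sum_le_sum fun n hn => ?_
        obtain ⟨hn1, hn2⟩ := Finset.mem_filter.mp hn
        have hn1 : 0 < n := (Finset.mem_Ico.mp hn1).1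
        have hsq := Real.mul_self_sqrt (Nat.cast_nonneg (α := ℝ) n)
        have he : D * n - γ * √(n : ℝ) = √(n : ℝ) * (D * √(n : ℝ) - γ) := by
          linear_combination (-D) * hsq
        have h1 : (1 + θ) * γ < D * √(n : ℝ) := by
          have := Real.lt_sqrt_of_sq_lt hn2
          rwa [div_lt_iff₀ hD, mul_comm (√(n : ℝ))] at this
        -- Two lower bounds for the deviation. Averaging their squares gives one factor that is
        -- small uniformly in `n` and one that is summable in `n`.
        have hu1 : θ * γ ≤ D * √(n : ℝ) - γ := by linarith
        have hu2 : θ / 2 * (D * √(n : ℝ)) ≤ D * √(n : ℝ) - γ := by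
          nlinarith [mul_pos hθ hγ, mul_nonneg hθ.le (sub_nonneg.mpr hθ1),
            mul_nonneg hγ.le (mul_nonneg hθ.le (sub_nonneg.mpr hθ1))]
        rw [he]
        refine (X.prob_reach_le a (by norm_num) hn1
          (le_trans (mul_pos hθ hγ).le hu1)).trans ?_
        rw [← Real.exp_add, Real.exp_le_exp]
        have h2 : (θ * γ) ^ 2 ≤ (D * √(n : ℝ) - γ) ^ 2 :=
          pow_le_pow_left₀ (by positivity) hu1 2
        have h3 : (θ / 2 * (D * √(n : ℝ))) ^ 2 ≤ (D * √(n : ℝ) - γ) ^ 2 :=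
          pow_le_pow_left₀ (by positivity) hu2 2
        have h4 : (θ / 2 * (D * √(n : ℝ))) ^ 2 = θ ^ 2 * D ^ 2 / 4 * n := by
          linear_combination (θ ^ 2 * D ^ 2 / 4) * hsq
        rw [h4] at h3
        rw [mul_pow] at h2
        linarith
    _ ≤ ∑ n ∈ Finset.Ico 1 (T + 1),
          Real.exp (-(θ ^ 2 * γ ^ 2 / 4)) * Real.exp (-(θ ^ 2 * D ^ 2 / 16 * n)) :=
        Finset.sum_le_sum_of_subset_of_nonneg (Finset.filter_subset _ _)
          fun _ _ _ => by positivity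
    _ ≤ _ := by
        rw [← Finset.mul_sum]
        refine mul_le_mul_of_nonneg_left ?_ (Real.exp_pos _).le
        refine (sum_exp_neg_mul_le (by positivity) T).trans (le_of_eq ?_)
        field_simp

theorem pullsBefore_eq (a : Fin K) (t : Fin T) (ω : X.Ω) :
    pullsBefore X.A a t ω = X.pulls a t ω := by
  ext s
  simp [pullsBefore, pulls]

theorem ucbIndex_eq (a : Fin K) (t : Fin T) (ω : X.Ω) (h : 1 ≤ X.count a t ω) :
    ucbIndex μ σ γ X.ξ X.A a t ω = μ a + σ * (X.noise a t ω / X.count a t ω +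
      γ / √(X.count a t ω : ℝ)) := by
  have hn : numPulls X.A a t ω = X.count a t ω := by rw [numPulls, pullsBefore_eq, count]
  have hsum : ∑ s ∈ X.pulls a t ω, reward μ σ X.ξ X.A s ω =
      X.count a t ω * μ a + σ * X.noise a t ω := by
    rw [noise, count, Finset.mul_sum, ← nsmul_eq_mul, ← Finset.sum_const,
      ← Finset.sum_add_distrib]
    refine Finset.sum_congr rfl fun s hs => ?_
    rw [reward, (Finset.mem_filter.mp hs).2.2]
  have h0 : (0 : ℝ) < X.count a t ω := Nat.cast_pos.mpr h
  rw [ucbIndex, empMean, hn, pullsBefore_eq, hsum]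
  field_simp
  ring

theorem le_of_one_le_count {a : Fin K} {t : Fin T} {ω : X.Ω} (hA : X.A t ω = a)
    (h : 1 ≤ X.count a t ω) : K ≤ (t : ℕ) := by
  by_contra hlt
  rw [not_le] at hlt
  obtain ⟨s, hs⟩ := Finset.card_pos.mp h
  obtain ⟨hst, hsa⟩ := (Finset.mem_filter.mp hs).2
  have := X.A_init ω (show (s : ℕ) < K from hst.trans hlt) (show (t : ℕ) < K from hlt)
    (show X.A s ω = X.A t ω by rw [hsa, hA])
  exact absurd hst (by rw [this]; exact lt_irrefl _)

theorem one_le_count (hKT : K ≤ T) (b : Fin K) {t : ℕ} (ht : K ≤ t) (ω : X.Ω) :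
    1 ≤ X.count b t ω := by
  have hinj : Function.Injective fun i : Fin K => X.A (Fin.castLE hKT i) ω := by
    intro i j hij
    have := X.A_init ω (show ((Fin.castLE hKT i : Fin T) : ℕ) < K from i.2)
      (show ((Fin.castLE hKT j : Fin T) : ℕ) < K from j.2) hij
    exact Fin.castLE_injective hKT this
  obtain ⟨i, hi⟩ := (Finite.injective_iff_surjective.mp hinj) b
  refine Finset.card_pos.mpr ⟨Fin.castLE hKT i, ?_⟩
  simp only [pulls, Finset.mem_filter, Finset.mem_univ, true_and]
  exact ⟨lt_of_lt_of_le i.2 ht, hi⟩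

/-- What it means for the index that arm `a` is pulled again. -/
theorem index_le (hKT : K ≤ T) (hσ : 0 < σ) {a : Fin K} {t : Fin T} {ω : X.Ω}
    (hA : X.A t ω = a) (h : 1 ≤ X.count a t ω) (b : Fin K) :
    (gap μ a - gap μ b) / σ + X.noise b t ω / X.count b t ω + γ / √(X.count b t ω : ℝ) ≤
      X.noise a t ω / X.count a t ω + γ / √(X.count a t ω : ℝ) := by
  have hK := X.le_of_one_le_count hA h
  have hs := X.A_step t hK ω b
  rw [hA, X.ucbIndex_eq b t ω (X.one_le_count hKT b hK ω), X.ucbIndex_eq a t ω h] at hs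
  have h1 : gap μ a - gap μ b = μ b - μ a := by simp [gap]
  rw [h1]
  have h2 : (μ b - μ a) / σ ≤ (X.noise a t ω / X.count a t ω + γ / √(X.count a t ω : ℝ)) -
      (X.noise b t ω / X.count b t ω + γ / √(X.count b t ω : ℝ)) := by
    rw [div_le_iff₀ hσ]; linarith
  linarith

theorem count_strict {a : Fin K} {s t : Fin T} {ω : X.Ω} (hA : X.A s ω = a) (h : s < t) :
    X.count a s ω < X.count a t ω := by
  have h1 := X.count_succ_of_eq hA
  have h2 : X.count a (s + 1) ω ≤ X.count a t ω := X.count_mono a ω (Nat.succ_le_of_lt h)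
  omega

/-- A bound on the number of pulls from a property of the counts at which the arm is pulled. -/
theorem count_le_of_forall (a : Fin K) (ω : X.Ω) {m : ℝ} (hm : 0 ≤ m) (Q : ℕ → Set X.Ω)
    (h : ∀ t : Fin T, X.A t ω = a → 1 ≤ X.count a t ω → (X.count a t ω : ℝ) ≤ m ∨
      ω ∈ Q (X.count a t ω)) :
    (X.count a T ω : ℝ) ≤ 1 + m + ∑ n ∈ Finset.Ico 1 (T + 1) with m < ((n : ℕ) : ℝ),
      (Q n).indicator (fun _ => (1 : ℝ)) ω := by
  classical
  -- The pulls of an arm are labelled injectively by the count just before them. Labels at most `m`,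
  -- including the label 0 of the first pull, number at most `⌊m⌋₊ + 1`.
  have hsub : (X.pulls a T ω).image (fun t : Fin T => X.count a t ω) ⊆
      Finset.range (⌊m⌋₊ + 1) ∪
        ((Finset.Ico 1 (T + 1)).filter (fun n : ℕ => m < (n : ℝ))).filter (fun n => ω ∈ Q n) := by
    intro n hn
    obtain ⟨t, ht, rfl⟩ := Finset.mem_image.mp hn
    have htA := (Finset.mem_filter.mp ht).2.2
    simp only [Finset.mem_union, Finset.mem_range, Finset.mem_filter, Finset.mem_Ico]
    by_cases h1 : (X.count a t ω : ℝ) ≤ m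
    · exact Or.inl (Nat.lt_succ_of_le (Nat.le_floor h1))
    · have h2 : 1 ≤ X.count a t ω := by
        by_contra h0
        have : X.count a t ω = 0 := by omega
        rw [this] at h1
        exact h1 (by simpa using hm)
      refine Or.inr ⟨⟨⟨h2, Nat.lt_succ_of_le (X.count_le a t ω)⟩, not_le.mp h1⟩, ?_⟩
      exact (h t htA h2).resolve_left h1
  have hinj : Set.InjOn (fun t : Fin T => X.count a t ω) (X.pulls a T ω : Set (Fin T)) := by
    intro s hs t ht hst
    have hsA := (Finset.mem_filter.mp (Finset.mem_coe.mp hs)).2.2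
    have htA := (Finset.mem_filter.mp (Finset.mem_coe.mp ht)).2.2
    rcases lt_trichotomy s t with hlt | heq | hlt
    · exact absurd hst (X.count_strict hsA hlt).ne
    · exact heq
    · exact absurd hst.symm (X.count_strict htA hlt).ne
  have hcard := (Finset.card_le_card hsub).trans (Finset.card_union_le _ _)
  rw [Finset.card_image_of_injOn hinj, Finset.card_range] at hcard
  have hsum : ∑ n ∈ Finset.Ico 1 (T + 1) with m < ((n : ℕ) : ℝ),
      (Q n).indicator (fun _ => (1 : ℝ)) ω = ((((Finset.Ico 1 (T + 1)).filter
        (fun n : ℕ => m < (n : ℝ))).filter (fun n => ω ∈ Q n)).card : ℝ) := by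
    rw [Finset.card_filter]
    push_cast
    refine Finset.sum_congr rfl fun n _ => ?_
    simp [Set.indicator_apply]
  rw [hsum]
  have hfl := Nat.floor_le hm
  have hc : (X.count a T ω : ℝ) ≤ (⌊m⌋₊ : ℝ) + 1 + ((((Finset.Ico 1 (T + 1)).filter
        (fun n : ℕ => m < (n : ℝ))).filter (fun n => ω ∈ Q n)).card : ℝ) := by
    exact_mod_cast hcard
  linarith

theorem integrable_count (a : Fin K) (t : ℕ) :
    Integrable (fun ω => (X.count a t ω : ℝ)) X.P := by
  refine Integrable.of_bound (C := T) ?_ ?_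
  · exact ((measurable_from_nat (f := fun n : ℕ => (n : ℝ))).comp
      (X.measurable_count a t)).aestronglyMeasurable
  · refine Filter.Eventually.of_forall fun ω => ?_
    rw [Real.norm_of_nonneg (Nat.cast_nonneg _)]
    exact_mod_cast X.count_le a t ω

theorem sum_gap_eq (ω : X.Ω) :
    ∑ t : Fin T, gap μ (X.A t ω) = ∑ a, gap μ a * X.count a T ω := by
  classical
  rw [← Finset.sum_fiberwise (s := Finset.univ) (g := fun t => X.A t ω)]
  refine Finset.sum_congr rfl fun a _ => ?_
  have h : X.pulls a T ω = Finset.univ.filter (fun t => X.A t ω = a) := by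
    ext s; simp [pulls]
  rw [count, h, mul_comm, ← nsmul_eq_mul, ← Finset.sum_const]
  exact Finset.sum_congr rfl fun t ht => by rw [(Finset.mem_filter.mp ht).2]

theorem sum_count (ω : X.Ω) : ∑ a, X.count a T ω = T := by
  classical
  have h : ∀ a, X.pulls a T ω = Finset.univ.filter (fun t => X.A t ω = a) := by
    intro a; ext s; simp [pulls]
  simp_rw [count, h]
  rw [← Finset.card_eq_sum_card_fiberwise (f := fun t => X.A t ω) (t := Finset.univ)
    (fun _ _ => Finset.mem_coe.mpr (Finset.mem_univ _))]
  simp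

/-- The noise enters the regret through the sum over all rounds, which is centred whatever the
choice of arms. -/
theorem regret_eq : X.regret = ∑ a, gap μ a * ∫ ω, (X.count a T ω : ℝ) ∂X.P := by
  have hξ : ∀ t, Integrable (X.ξ t) X.P := by
    intro t
    have h : Integrable id (X.P.map (X.ξ t)) := by
      rw [X.ξ_law t]
      exact (memLp_id_gaussianReal 1).integrable (by norm_num)
    exact h.comp_measurable (X.ξ_meas t)
  have hξ0 : ∀ t, ∫ ω, X.ξ t ω ∂X.P = 0 := by
    intro t
    have h := integral_map (μ := X.P) (φ := X.ξ t) (X.ξ_meas t).aemeasurable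
      (f := fun x : ℝ => x) aestronglyMeasurable_id
    rw [X.ξ_law t, integral_id_gaussianReal] at h
    exact h.symm
  have hpt : ∀ ω, ∑ t : Fin T, (optMean μ - reward μ σ X.ξ X.A t ω) =
      ∑ a, gap μ a * X.count a T ω - σ * ∑ t, X.ξ t ω := by
    intro ω
    rw [← X.sum_gap_eq, Finset.mul_sum, ← Finset.sum_sub_distrib]
    exact Finset.sum_congr rfl fun t _ => by rw [reward, gap]; ring
  rw [regret]
  simp_rw [hpt]
  rw [integral_sub, integral_finsetSum, integral_const_mul, integral_finsetSum]
  · simp_rw [hξ0, integral_const_mul]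
    simp
  · exact fun t _ => hξ t
  · exact fun a _ => (X.integrable_count a T).const_mul _
  · exact integrable_finsetSum _ fun a _ => (X.integrable_count a T).const_mul _
  · exact (integrable_finsetSum _ fun t _ => hξ t).const_mul _

end UCB1Run
end Bandit

/-! ### The tolerance, and two-sided bounds on the pulls of a suboptimal arm. -/

namespace Bandit

/-- The accuracy `2 √(log log T / log T)`. -/
def accuracy (T : ℕ) : ℝ := 2 * √(Real.log (Real.log T) / Real.log T)

section Numerics

variable {T : ℕ} (hT : Real.exp 100 ≤ T)
include hT

theorem hundred_le_log : 100 ≤ Real.log T :=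
  (Real.le_log_iff_exp_le ((Real.exp_pos _).trans_le hT)).mpr hT

theorem one_le_log_log : 1 ≤ Real.log (Real.log T) := by
  have h := hundred_le_log hT
  rw [Real.le_log_iff_exp_le (by linarith)]
  linarith [Real.exp_one_lt_d9]

theorem accuracy_sq_mul : accuracy T ^ 2 * Real.log T = 4 * Real.log (Real.log T) := by
  have h := hundred_le_log hT
  have h1 := one_le_log_log hT
  rw [accuracy, mul_pow, Real.sq_sqrt (div_nonneg (by linarith) (by linarith))]
  field_simp
  norm_num

theorem accuracy_pos : 0 < accuracy T := by
  have h := hundred_le_log hT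
  have h1 := one_le_log_log hT
  exact mul_pos two_pos (Real.sqrt_pos.mpr (div_pos (by linarith) (by linarith)))

theorem accuracy_le_half : accuracy T ≤ 1 / 2 := by
  have h := hundred_le_log hT
  have h1 := accuracy_sq_mul hT
  -- Tangent line of the logarithm at 100. This is where the threshold $\log T\ge100$ suffices.
  have h2 : Real.log (Real.log T) ≤ Real.log T / 100 + 4 := by
    have h3 : Real.log (Real.log T) = Real.log (Real.log T / 100) + Real.log 100 := by
      rw [← Real.log_mul (by positivity) (by norm_num)]; congr 1; ring
    have h4 := Real.log_le_sub_one_of_pos (x := Real.log T / 100) (by positivity)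
    have h5 : Real.log 100 ≤ 5 := by
      rw [Real.log_le_iff_le_exp (by norm_num)]
      have : Real.exp 5 = Real.exp 1 ^ 5 := by rw [← Real.exp_nat_mul]; norm_num
      rw [this]
      calc (100 : ℝ) ≤ 2.7 ^ 5 := by norm_num
        _ ≤ Real.exp 1 ^ 5 :=
          pow_le_pow_left₀ (by norm_num) (by linarith [Real.exp_one_gt_d9]) 5
    linarith
  by_contra hlt
  rw [not_le] at hlt
  have : (1 / 2 : ℝ) ^ 2 < accuracy T ^ 2 := pow_lt_pow_left₀ hlt (by norm_num) two_ne_zero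
  nlinarith

theorem inv_log_le_accuracy : 1 / Real.log T ≤ accuracy T := by
  have h := hundred_le_log hT
  have h1 := one_le_log_log hT
  have h2 := accuracy_sq_mul hT
  have h3 := accuracy_pos hT
  have h4 := accuracy_le_half hT
  rw [div_le_iff₀ (by linarith)]
  nlinarith [mul_le_mul_of_nonneg_right h4 (mul_pos h3 (by linarith : 0 < Real.log T)).le]

/-- This identity motivates the factor 2 in `accuracy`: the value $1/\log^2T$ absorbs the $O(\log
T)$ dyadic blocks of the peeling and still leaves $O(1/\log T)$, which is below the tolerance. -/
theorem exp_accuracy : Real.exp (-(accuracy T ^ 2 * Real.log T / 2)) = 1 / Real.log T ^ 2 := by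
  have h := hundred_le_log hT
  rw [accuracy_sq_mul hT, show -(4 * Real.log (Real.log T) / 2) =
    -(Real.log (Real.log T) + Real.log (Real.log T)) by ring, Real.exp_neg, Real.exp_add,
    Real.exp_log (by linarith)]
  rw [one_div, sq]

theorem natLog_add_one_le : (Nat.log 2 T : ℝ) + 1 ≤ 3 * Real.log T := by
  have h := hundred_le_log hT
  have h1 : (Nat.log 2 T : ℝ) * Real.log 2 ≤ Real.log T := by
    rw [← Real.log_pow]
    refine Real.log_le_log (by positivity) ?_
    have hT0 : T ≠ 0 := by
      rintro rfl
      simp at h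
      linarith
    exact_mod_cast Nat.pow_log_le_self 2 hT0
  have h2 := Real.log_two_gt_d9
  have h3 : (0 : ℝ) ≤ Nat.log 2 T := Nat.cast_nonneg _
  nlinarith

end Numerics

theorem le_index_iff {n : ℕ} (hn : 1 ≤ n) {c s γ : ℝ} :
    c ≤ s / n + γ / √(n : ℝ) ↔ c * n - γ * √(n : ℝ) ≤ s := by
  have hn' : (0 : ℝ) < n := Nat.cast_pos.mpr hn
  have h1 : γ / √(n : ℝ) = γ * √(n : ℝ) / n := by
    have := Real.mul_self_sqrt hn'.le
    rw [div_eq_div_iff (Real.sqrt_pos.mpr hn').ne' hn'.ne', mul_assoc, this]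
  rw [h1, ← add_div, le_div_iff₀ hn', sub_le_iff_le_add]

attribute [local instance] UCB1Run.mΩ UCB1Run.isProb

namespace UCB1Run

variable {T K : ℕ} {μ : Fin K → ℝ} {σ γ : ℝ} (X : UCB1Run.{u} T K μ σ γ)

theorem integrable_indicator_one {s : Set X.Ω} (hs : MeasurableSet s) :
    Integrable (s.indicator fun _ => (1 : ℝ)) X.P :=
  (integrable_const 1).indicator hs

theorem integral_indicator_one_eq {s : Set X.Ω} (hs : MeasurableSet s) :
    ∫ ω, s.indicator (fun _ => (1 : ℝ)) ω ∂X.P = X.P.real s :=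
  integral_indicator_one hs

/-- Here `c` bounds from below the normalized excess of the index of `b` over its mean, and `y` is
the resulting effective gap that arm `a` has to overcome. The upper bounds on the pulls differ only
in the available `c`: slightly negative in general, positive for a rarely pulled optimal arm. -/
theorem reach_of_not_crossing (hKT : K ≤ T) (hσ : 0 < σ) {a b : Fin K} {c y : ℝ} {t : Fin T}
    {ω : X.Ω} (hA : X.A t ω = a) (h : 1 ≤ X.count a t ω)
    (hb : c ≤ X.noise b t ω / X.count b t ω + γ / √(X.count b t ω : ℝ))
    (hy : y = (gap μ a - gap μ b) / σ + c) :
    ω ∈ X.reach a 1 (X.count a t ω)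
      (y * (X.count a t ω : ℕ) - γ * √((X.count a t ω : ℕ) : ℝ)) := by
  refine ⟨t, t.2.le, rfl, ?_⟩
  rw [one_mul, ← le_index_iff h, hy]
  linarith [X.index_le hKT hσ hA h b]

theorem index_ge_of_notMem_crossing (hKT : K ≤ T) {b : Fin K} {x : ℝ} {t : Fin T} {ω : X.Ω}
    (ht : K ≤ (t : ℕ))
    (hω : ω ∉ X.crossing b (-1) fun n => γ * √(n : ℝ) + x * n) :
    -x ≤ X.noise b t ω / X.count b t ω + γ / √(X.count b t ω : ℝ) := by
  have h1 := X.one_le_count hKT b ht ω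
  rw [le_index_iff h1]
  by_contra hlt
  refine hω ⟨t, t.2.le, h1, ?_⟩
  simp only
  linarith

theorem sum_prob_reach_accuracy_le (hT : Real.exp 100 ≤ T) (hγ : 0 < γ)
    (hγ2 : γ ^ 2 = 2 * Real.log T) (a : Fin K) {D : ℝ} (hD : 0 < D) :
    ∑ n ∈ Finset.Ico 1 (T + 1) with ((1 + accuracy T) * γ / D) ^ 2 < ((n : ℕ) : ℝ),
      X.P.real (X.reach a 1 n (D * n - γ * √(n : ℝ))) ≤ γ ^ 2 / D ^ 2 * accuracy T := by
  have hℓ := hundred_le_log hT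
  have hδ := accuracy_pos hT
  have hδ1 := accuracy_le_half hT
  refine (X.sum_prob_reach_le a hγ hδ (by linarith) hD).trans ?_
  have he : accuracy T ^ 2 * γ ^ 2 / 4 = accuracy T ^ 2 * Real.log T / 2 := by
    rw [hγ2]; ring
  have h1 := one_le_log_log hT
  have h2 := accuracy_sq_mul hT
  have h3 := inv_log_le_accuracy hT
  rw [he, exp_accuracy hT, hγ2]
  have h4 : 1 / Real.log T ^ 2 * (16 / (accuracy T ^ 2 * D ^ 2)) =
      16 / (Real.log T * (accuracy T ^ 2 * Real.log T) * D ^ 2) := by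
    field_simp
  rw [h4, h2]
  calc 16 / (Real.log T * (4 * Real.log (Real.log T)) * D ^ 2)
      ≤ 16 / (Real.log T * (4 * 1) * D ^ 2) := by gcongr
    _ = 2 * 2 / D ^ 2 * (1 / Real.log T) := by field_simp; norm_num
    _ ≤ 2 * Real.log T / D ^ 2 * accuracy T := by gcongr; linarith

/-- The exploration rate is tuned so that $e^{-\gamma^2/2}=1/T$ cancels the trivial count `T`
charged on the bad event. -/
theorem mul_prob_crossing_index_le (hT : 0 < T) (hγ : 0 < γ) (hγ2 : γ ^ 2 = 2 * Real.log T)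
    (b : Fin K) {x : ℝ} (hx : 0 < x) :
    T * X.P.real (X.crossing b (-1) fun n => γ * √(n : ℝ) + x * n) ≤ 2 / (γ * x) ^ 2 := by
  have hT' : (0 : ℝ) < T := Nat.cast_pos.mpr hT
  have h := X.prob_crossing_index_le b hγ hx
  have he : Real.exp (-(γ ^ 2 / 2)) = 1 / T := by
    rw [hγ2, mul_div_cancel_left₀ _ two_ne_zero, Real.exp_neg, Real.exp_log hT', one_div]
  rw [he] at h
  calc _ ≤ T * (1 / T * (2 / (γ * x) ^ 2)) := mul_le_mul_of_nonneg_left h hT'.le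
    _ = _ := by field_simp

/-- Upper bound on the expected number of pulls of a suboptimal arm. -/
theorem integral_count_le (hKT : K ≤ T) (hT : Real.exp 100 ≤ T) (hσ : 0 < σ) (hγ : 0 < γ)
    (hγ2 : γ ^ 2 = 2 * Real.log T) {a b : Fin K} (ha : 0 < gap μ a) (hb : gap μ b = 0) :
    ∫ ω, (X.count a T ω : ℝ) ∂X.P ≤
      1 + γ ^ 2 / (gap μ a / σ) ^ 2 * (1 + 23 * accuracy T) := by
  set d := gap μ a / σ with hd
  have hd0 : 0 < d := div_pos ha hσ
  set δ := accuracy T with hδdef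
  have hℓ := hundred_le_log hT
  have hδ : 0 < δ := accuracy_pos hT
  have hδ1 : δ ≤ 1 / 2 := accuracy_le_half hT
  have hT0 : 0 < T := by
    rcases Nat.eq_zero_or_pos T with h | h
    · rw [h] at hℓ; simp at hℓ; linarith
    · exact h
  -- The gap left after allowing the optimal index to fall short by the fraction `δ` of the gap.
  set D := d * (1 - δ) with hD
  have hD0 : 0 < D := mul_pos hd0 (by linarith)
  set m := ((1 + δ) * γ / D) ^ 2 with hm
  set F := X.crossing b (-1) fun n => γ * √(n : ℝ) + (δ * d) * n with hF
  have hFm : MeasurableSet F := X.measurableSet_crossing _ _ _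
  have hRm : ∀ n : ℕ, MeasurableSet (X.reach a 1 n (D * n - γ * √(n : ℝ))) :=
    fun n => X.measurableSet_reach _ _ _ _
  have hpt : ∀ ω, (X.count a T ω : ℝ) ≤
      1 + m + ∑ n ∈ Finset.Ico 1 (T + 1) with m < ((n : ℕ) : ℝ),
        (X.reach a 1 n (D * n - γ * √(n : ℝ))).indicator (fun _ => (1 : ℝ)) ω +
      T * F.indicator (fun _ => (1 : ℝ)) ω := by
    intro ω
    have hs0 : 0 ≤ ∑ n ∈ Finset.Ico 1 (T + 1) with m < ((n : ℕ) : ℝ),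
        (X.reach a 1 n (D * n - γ * √(n : ℝ))).indicator (fun _ => (1 : ℝ)) ω :=
      Finset.sum_nonneg fun n _ => Set.indicator_nonneg (fun _ _ => zero_le_one) ω
    by_cases hω : ω ∈ F
    · rw [Set.indicator_of_mem hω]
      have h1 : (X.count a T ω : ℝ) ≤ T := by exact_mod_cast X.count_le a T ω
      have h2 : 0 ≤ m := sq_nonneg _
      linarith
    · rw [Set.indicator_of_notMem hω, mul_zero, add_zero]
      refine X.count_le_of_forall a ω (sq_nonneg _) _ fun t hA h1 => Or.inr ?_
      refine X.reach_of_not_crossing hKT hσ hA h1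
        (X.index_ge_of_notMem_crossing hKT (X.le_of_one_le_count hA h1) hω) ?_
      rw [hb, sub_zero, ← hd, hD]; ring
  have hint : ∫ ω, (X.count a T ω : ℝ) ∂X.P ≤
      1 + m + ∑ n ∈ Finset.Ico 1 (T + 1) with m < ((n : ℕ) : ℝ),
        X.P.real (X.reach a 1 n (D * n - γ * √(n : ℝ))) + T * X.P.real F := by
    have hi1 : Integrable (fun ω => ∑ n ∈ Finset.Ico 1 (T + 1) with m < ((n : ℕ) : ℝ),
        (X.reach a 1 n (D * n - γ * √(n : ℝ))).indicator (fun _ => (1 : ℝ)) ω) X.P :=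
      integrable_finsetSum _ fun n _ => X.integrable_indicator_one (hRm n)
    have hi2 := (X.integrable_indicator_one hFm).const_mul (T : ℝ)
    have hi3 : Integrable (fun ω => 1 + m + ∑ n ∈ Finset.Ico 1 (T + 1) with m < ((n : ℕ) : ℝ),
        (X.reach a 1 n (D * n - γ * √(n : ℝ))).indicator (fun _ => (1 : ℝ)) ω) X.P :=
      (integrable_const (1 + m)).add hi1
    refine (integral_mono (X.integrable_count a T) (hi3.add hi2) hpt).trans (le_of_eq ?_)
    simp only [Pi.add_apply]
    rw [integral_add hi3 hi2, integral_add (integrable_const _) hi1,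
      integral_finsetSum _ fun n _ => X.integrable_indicator_one (hRm n), integral_const_mul,
      X.integral_indicator_one_eq hFm]
    simp_rw [fun n : ℕ => X.integral_indicator_one_eq (hRm n)]
    simp
  have h1 := X.sum_prob_reach_accuracy_le hT hγ hγ2 a hD0
  have h2 := X.mul_prob_crossing_index_le hT0 hγ hγ2 b (mul_pos hδ hd0)
  have h3 : 2 / (γ * (δ * d)) ^ 2 ≤ γ ^ 2 / d ^ 2 * δ := by
    have e1 : (γ * (δ * d)) ^ 2 = 8 * Real.log (Real.log T) * d ^ 2 := by
      have := accuracy_sq_mul hT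
      rw [← hδdef] at this
      rw [mul_pow, mul_pow, hγ2]
      linear_combination 2 * d ^ 2 * this
    rw [e1, hγ2]
    have e2 := one_le_log_log hT
    have e3 := inv_log_le_accuracy hT
    rw [← hδdef] at e3
    calc 2 / (8 * Real.log (Real.log T) * d ^ 2) ≤ 2 / (8 * 1 * d ^ 2) := by gcongr
      _ ≤ 2 * 1 / d ^ 2 := by
        rw [div_le_div_iff₀ (by positivity) (by positivity)]
        nlinarith [sq_nonneg d]
      _ = 2 * Real.log T / d ^ 2 * (1 / Real.log T) := by field_simp
      _ ≤ _ := by gcongr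
  have h4 : 1 / (1 - δ) ^ 2 ≤ 1 + 6 * δ := by
    rw [div_le_iff₀ (by nlinarith)]
    have : 0 ≤ δ * (1 - 2 * δ) * (4 - 3 * δ) :=
      mul_nonneg (mul_nonneg hδ.le (by linarith)) (by linarith)
    nlinarith
  have h5 : m = γ ^ 2 / d ^ 2 * ((1 + δ) ^ 2 * (1 / (1 - δ) ^ 2)) := by
    rw [hm, hD]; field_simp
  have h6 : γ ^ 2 / D ^ 2 * δ = γ ^ 2 / d ^ 2 * (δ * (1 / (1 - δ) ^ 2)) := by
    rw [hD]; field_simp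
  have hg : 0 < γ ^ 2 / d ^ 2 := by positivity
  -- The three summands are the threshold `m`, the late deviations of arm `a`, and the failure of
  -- the optimal index.
  have h7 : (1 + δ) ^ 2 * (1 / (1 - δ) ^ 2) + δ * (1 / (1 - δ) ^ 2) + δ ≤ 1 + 23 * δ := by
    have : ((1 + δ) ^ 2 + δ) * (1 / (1 - δ) ^ 2) ≤ (1 + 4 * δ) * (1 + 6 * δ) :=
      mul_le_mul (by nlinarith) h4 (by positivity) (by positivity)
    nlinarith
  have h8 := mul_le_mul_of_nonneg_left h7 hg.le
  rw [← hδdef, ← hm, h6] at h1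
  linarith

theorem exists_last_pull (b : Fin K) (ω : X.Ω) (h : 1 ≤ X.count b T ω) :
    ∃ t : Fin T, X.A t ω = b ∧ X.count b t ω + 1 = X.count b T ω := by
  have hne : (X.pulls b T ω).Nonempty := Finset.card_pos.mp h
  refine ⟨(X.pulls b T ω).max' hne, ?_⟩
  have hmem := Finset.max'_mem _ hne
  set t := (X.pulls b T ω).max' hne with ht
  have hA : X.A t ω = b := (Finset.mem_filter.mp hmem).2.2
  refine ⟨hA, ?_⟩
  rw [← X.count_succ_of_eq hA, count, count]
  congr 1
  ext s
  constructor
  · intro hs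
    have := (Finset.mem_filter.mp hs).2.2
    exact Finset.mem_filter.mpr ⟨Finset.mem_univ _, s.2, this⟩
  · intro hs
    have h1 := Finset.le_max' _ s hs
    exact Finset.mem_filter.mpr ⟨Finset.mem_univ _, Nat.lt_succ_of_le h1,
      (Finset.mem_filter.mp hs).2.2⟩

theorem gap_nonneg (μ : Fin K → ℝ) (a : Fin K) : 0 ≤ gap μ a :=
  sub_nonneg.mpr (le_ciSup (Set.finite_range μ).bddAbove a)

/-- Lower bound on the number of pulls of a suboptimal arm, off three rare events. -/
theorem count_ge (hK : 0 < K) (hKT : 4 * K ≤ T) (hℓ : 0 < Real.log T) (hσ : 0 < σ) (hγ : 0 < γ)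
    (hγ2 : γ ^ 2 = 2 * Real.log T) {L δ : ℝ} (hL : 0 < L) (hδ1 : δ ≤ 1)
    {a : Fin K} (ha : 0 < gap μ a)
    (haL : L * √(K * Real.log T / T) ≤ gap μ a / σ) (ω : X.Ω) :
    ((1 - δ) * γ / (gap μ a / σ * (1 + 9 / L))) ^ 2 *
      (1 - 2 / T * ∑ c with 0 < gap μ c, (X.count c T ω : ℝ)
        - (⋃ b, X.crossing b 1 fun n => (2 * γ) * √(n : ℝ)).indicator (fun _ => (1 : ℝ)) ω
        - (X.crossing a (-1) fun n => (δ * γ) * √(n : ℝ)).indicator (fun _ => (1 : ℝ)) ω) ≤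
      X.count a T ω := by
  classical
  set d := gap μ a / σ with hd
  have hd0 : 0 < d := div_pos ha hσ
  have hT0 : 0 < T := by omega
  have hT' : (0 : ℝ) < T := Nat.cast_pos.mpr hT0
  have hK' : (0 : ℝ) < K := Nat.cast_pos.mpr hK
  set E₂ := ⋃ b, X.crossing b 1 fun n => (2 * γ) * √(n : ℝ) with hE₂
  set E₃ := X.crossing a (-1) fun n => (δ * γ) * √(n : ℝ) with hE₃
  have hi2 : 0 ≤ E₂.indicator (fun _ => (1 : ℝ)) ω :=
    Set.indicator_nonneg (fun _ _ => zero_le_one) ω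
  have hi3 : 0 ≤ E₃.indicator (fun _ => (1 : ℝ)) ω :=
    Set.indicator_nonneg (fun _ _ => zero_le_one) ω
  have hs0 : 0 ≤ 2 / (T : ℝ) * ∑ c with 0 < gap μ c, (X.count c T ω : ℝ) := by positivity
  have hc0 : (0 : ℝ) ≤ X.count a T ω := Nat.cast_nonneg _
  have hn0 : 0 ≤ ((1 - δ) * γ / (d * (1 + 9 / L))) ^ 2 := sq_nonneg _
  -- On each rare event the bracket is nonpositive and there is nothing to prove. For the event that
  -- the suboptimal arms take half of the rounds this is Markov's inequality in pathwise form.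
  have triv : ∀ z : ℝ, z ≤ 0 → ((1 - δ) * γ / (d * (1 + 9 / L))) ^ 2 * z ≤ X.count a T ω :=
    fun z hz => (mul_nonpos_of_nonneg_of_nonpos hn0 hz).trans hc0
  by_cases h2 : ω ∈ E₂
  · refine triv _ ?_
    rw [Set.indicator_of_mem h2]; linarith
  by_cases h3 : ω ∈ E₃
  · refine triv _ ?_
    rw [Set.indicator_of_mem h3]; linarith
  by_cases h1 : (T : ℝ) / 2 ≤ ∑ c with 0 < gap μ c, (X.count c T ω : ℝ)
  · refine triv _ ?_
    have : 1 ≤ 2 / (T : ℝ) * ∑ c with 0 < gap μ c, (X.count c T ω : ℝ) := by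
      calc (1 : ℝ) = 2 / (T : ℝ) * (T / 2) := by field_simp
        _ ≤ _ := mul_le_mul_of_nonneg_left h1 (by positivity)
    linarith
  rw [not_le] at h1
  -- Pigeonhole: more than half of the rounds go to at most `K` optimal arms.
  have hopt : ∃ b, ¬ 0 < gap μ b ∧ (T : ℝ) / (2 * K) < X.count b T ω := by
    by_contra hcon
    push Not at hcon
    have hsum : ∑ c with 0 < gap μ c, (X.count c T ω : ℝ) +
        ∑ c with ¬ 0 < gap μ c, (X.count c T ω : ℝ) = T := by
      rw [Finset.sum_filter_add_sum_filter_not]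
      exact_mod_cast X.sum_count ω
    have hle : ∑ c with ¬ 0 < gap μ c, (X.count c T ω : ℝ) ≤ T / 2 := by
      calc _ ≤ ∑ c with ¬ 0 < gap μ c, (T : ℝ) / (2 * K) :=
            Finset.sum_le_sum fun c hc => hcon c (not_lt.mp (Finset.mem_filter.mp hc).2)
        _ ≤ ∑ c : Fin K, (T : ℝ) / (2 * K) :=
            Finset.sum_le_sum_of_subset_of_nonneg (Finset.filter_subset _ _)
              fun _ _ _ => by positivity
        _ = T / 2 := by
            rw [Finset.sum_const, Finset.card_univ, Fintype.card_fin, nsmul_eq_mul]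
            field_simp
    linarith
  obtain ⟨b, hb, hbT⟩ := hopt
  have hb0 : gap μ b = 0 := le_antisymm (not_lt.mp hb) (gap_nonneg μ b)
  have hKT' : (4 : ℝ) * K ≤ T := by exact_mod_cast hKT
  have hcb : 1 ≤ X.count b T ω := by
    have : (0 : ℝ) < X.count b T ω := lt_trans (by positivity) hbT
    exact_mod_cast this
  obtain ⟨t, hA, htb⟩ := X.exists_last_pull b ω hcb
  -- The count before the last pull is smaller by one, which `4 * K ≤ T` absorbs.
  have hNb : (T : ℝ) / (4 * K) ≤ X.count b t ω := by
    have e1 : (X.count b t ω : ℝ) + 1 = X.count b T ω := by exact_mod_cast htb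
    have e2 : (1 : ℝ) ≤ T / (4 * K) := by rw [le_div_iff₀ (by positivity)]; linarith
    have e3 : (T : ℝ) / (2 * K) = T / (4 * K) + T / (4 * K) := by field_simp; norm_num
    linarith
  have hNb0 : (0 : ℝ) < X.count b t ω := lt_of_lt_of_le (by positivity) hNb
  have hNb1 : 1 ≤ X.count b t ω := by exact_mod_cast hNb0
  have hKt := X.le_of_one_le_count hA hNb1
  have hNa1 := X.one_le_count (by omega) a hKt ω
  have hidx := X.index_le (by omega) hσ hA hNb1 a
  have hSb : X.noise b t ω ≤ 2 * γ * √(X.count b t ω : ℝ) := by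
    by_contra hlt
    refine h2 (Set.mem_iUnion.mpr ⟨b, t, t.2.le, hNb1, ?_⟩)
    simp only; linarith
  have hSa : -(δ * γ * √(X.count a t ω : ℝ)) ≤ X.noise a t ω := by
    by_contra hlt
    refine h3 ⟨t, t.2.le, hNa1, ?_⟩
    simp only; linarith
  -- Noise at most $2\gamma$ and bonus $\gamma$, in units of $1/\sqrt{n_b}$, add up to
  -- $3\gamma\sqrt{4K/T}=6\sqrt2\,\sqrt{K\log T/T}$, and $6\sqrt2\le9$.
  have hB : X.noise b t ω / X.count b t ω + γ / √(X.count b t ω : ℝ) ≤ 9 / L * d := by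
    have e1 : X.noise b t ω / X.count b t ω + γ / √(X.count b t ω : ℝ) ≤
        3 * γ / √(X.count b t ω : ℝ) := by
      have e2 : X.noise b t ω / X.count b t ω ≤ 2 * γ / √(X.count b t ω : ℝ) := by
        rw [div_le_div_iff₀ hNb0 (Real.sqrt_pos.mpr hNb0)]
        calc _ ≤ 2 * γ * √(X.count b t ω : ℝ) * √(X.count b t ω : ℝ) :=
              mul_le_mul_of_nonneg_right hSb (Real.sqrt_nonneg _)
          _ = _ := by rw [mul_assoc, Real.mul_self_sqrt hNb0.le]
      calc _ ≤ 2 * γ / √(X.count b t ω : ℝ) + γ / √(X.count b t ω : ℝ) := by linarith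
        _ = _ := by ring
    refine e1.trans ?_
    have e3 : 3 * γ / √(X.count b t ω : ℝ) ≤ 3 * γ / √((T : ℝ) / (4 * K)) := by
      gcongr
    have e4 : 3 * γ / √((T : ℝ) / (4 * K)) ≤ 9 * √(K * Real.log T / T) := by
      rw [div_le_iff₀ (Real.sqrt_pos.mpr (by positivity))]
      refine (pow_le_pow_iff_left₀ (by positivity) (by positivity) two_ne_zero).mp ?_
      rw [mul_pow, mul_pow, mul_pow, Real.sq_sqrt (by positivity), Real.sq_sqrt (by positivity),
        hγ2]
      field_simp
      norm_num
    have e5 : 9 * √(K * Real.log T / T) ≤ 9 / L * d := by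
      calc 9 * √(K * Real.log T / T) = 9 / L * (L * √(K * Real.log T / T)) := by field_simp
        _ ≤ _ := mul_le_mul_of_nonneg_left haL (by positivity)
    linarith
  have hNa0 : (0 : ℝ) < X.count a t ω := Nat.cast_pos.mpr hNa1
  have hmain : (1 - δ) * γ ≤ d * (1 + 9 / L) * √(X.count a t ω : ℝ) := by
    rw [hb0, zero_sub, neg_div, ← hd] at hidx
    have e1 : -(δ * γ) / √(X.count a t ω : ℝ) ≤ X.noise a t ω / X.count a t ω := by
      rw [div_le_div_iff₀ (Real.sqrt_pos.mpr hNa0) hNa0]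
      calc -(δ * γ) * X.count a t ω =
            -(δ * γ * √(X.count a t ω : ℝ)) * √(X.count a t ω : ℝ) := by
              have := Real.mul_self_sqrt hNa0.le
              linear_combination (δ * γ) * this
        _ ≤ _ := mul_le_mul_of_nonneg_right hSa (Real.sqrt_nonneg _)
    rw [← div_le_iff₀ (Real.sqrt_pos.mpr hNa0)]
    have e2 : (1 - δ) * γ / √(X.count a t ω : ℝ) =
        -(δ * γ) / √(X.count a t ω : ℝ) + γ / √(X.count a t ω : ℝ) := by ring
    rw [e2]
    linarith
  have hsq : ((1 - δ) * γ / (d * (1 + 9 / L))) ^ 2 ≤ X.count a t ω := by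
    have e1 : (1 - δ) * γ / (d * (1 + 9 / L)) ≤ √(X.count a t ω : ℝ) := by
      rw [div_le_iff₀ (by positivity)]; linarith
    calc _ ≤ √(X.count a t ω : ℝ) ^ 2 :=
          pow_le_pow_left₀ (div_nonneg (mul_nonneg (by linarith) hγ.le) (by positivity)) e1 2
      _ = _ := Real.sq_sqrt hNa0.le
  have hmono : (X.count a t ω : ℝ) ≤ X.count a T ω := by
    exact_mod_cast X.count_mono a ω t.2.le
  refine le_trans (mul_le_of_le_one_right hn0 ?_) (hsq.trans hmono)
  linarith

end UCB1Run
end Bandit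

/-! ### From pull counts to the ratio of regrets: large gaps and small gaps. -/

namespace Bandit

theorem exists_gap_eq_zero {K : ℕ} (hK : 0 < K) (μ : Fin K → ℝ) : ∃ b, gap μ b = 0 := by
  have : Nonempty (Fin K) := ⟨⟨0, hK⟩⟩
  obtain ⟨b, hb⟩ := exists_eq_ciSup_of_finite (f := μ)
  exact ⟨b, by rw [gap, optMean, hb, sub_self]⟩

theorem laiRobbins_pos {T K : ℕ} {σ : ℝ} (hℓ : 0 < Real.log T) (hσ : 0 < σ) {Δ : Fin K → ℝ}
    {a : Fin K} (ha : 0 < Δ a) : 0 < laiRobbins T σ Δ := by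
  refine mul_pos (by linarith) (Finset.sum_pos (fun c hc => ?_) ⟨a, by simpa using ha⟩)
  have := (Finset.mem_filter.mp hc).2
  positivity

/-- For factors at most one the deficits add up under multiplication. `Z` may be negative, so the
argument uses only products of nonnegative deficits. -/
theorem one_sub_le_mul {δ L Z q q' : ℝ} (hδ0 : 0 < δ) (hδ1 : δ ≤ 1 / 2) (hL : 0 < L)
    (hq : q = q' - 2 * δ - 18 / L) (hZ1 : Z ≤ 1) (hZ2 : 1 - q ≤ Z) :
    1 - q' ≤ (1 - δ) ^ 2 * (1 / (1 + 9 / L) ^ 2) * Z := by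
  have hA1 : (1 - δ) ^ 2 ≤ 1 := by nlinarith
  have hA2 : 1 - 2 * δ ≤ (1 - δ) ^ 2 := by nlinarith
  have hL9 : 0 < 9 / L := by positivity
  have hB0 : 0 < 1 / (1 + 9 / L) ^ 2 := by positivity
  have hB1 : 1 / (1 + 9 / L) ^ 2 ≤ 1 := by
    rw [div_le_one (by positivity)]
    nlinarith
  have hB2 : 1 - 18 / L ≤ 1 / (1 + 9 / L) ^ 2 := by
    rw [le_div_iff₀ (by positivity), show 18 / L = 2 * (9 / L) by ring]
    nlinarith [pow_pos hL9 3, pow_pos hL9 2]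
  generalize (1 - δ) ^ 2 = A at *
  generalize 1 / (1 + 9 / L) ^ 2 = B at *
  have hAB1 : A * B ≤ 1 := mul_le_one₀ hA1 hB0.le hB1
  have e1 := mul_nonneg (sub_nonneg.mpr hA1) (sub_nonneg.mpr hB1)
  have e2 := mul_nonneg (sub_nonneg.mpr hAB1) (sub_nonneg.mpr hZ1)
  linarith

attribute [local instance] UCB1Run.mΩ UCB1Run.isProb

namespace UCB1Run

variable {T K : ℕ} {μ : Fin K → ℝ} {σ γ : ℝ} (X : UCB1Run.{u} T K μ σ γ)

theorem regret_eq_sum_filter :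
    X.regret = ∑ a with 0 < gap μ a, gap μ a * ∫ ω, (X.count a T ω : ℝ) ∂X.P := by
  rw [X.regret_eq, Finset.sum_filter]
  refine Finset.sum_congr rfl fun a _ => ?_
  split_ifs with h
  · rfl
  · rw [le_antisymm (not_lt.mp h) (gap_nonneg μ a), zero_mul]

theorem laiRobbins_eq_sum (hσ : 0 < σ) (hγ2 : γ ^ 2 = 2 * Real.log T) :
    laiRobbins T σ (gap μ) = ∑ a with 0 < gap μ a, gap μ a * (γ ^ 2 / (gap μ a / σ) ^ 2) := by
  rw [laiRobbins, Finset.mul_sum]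
  refine Finset.sum_congr rfl fun a ha => ?_
  have := (Finset.mem_filter.mp ha).2
  rw [hγ2]
  field_simp

theorem le_ratio (hℓ : 0 < Real.log T) (hσ : 0 < σ) (hγ2 : γ ^ 2 = 2 * Real.log T)
    {a : Fin K} (ha : 0 < gap μ a) {r : ℝ} (h : ∀ c, 0 < gap μ c →
      γ ^ 2 / (gap μ c / σ) ^ 2 * r ≤ ∫ ω, (X.count c T ω : ℝ) ∂X.P) :
    r ≤ X.regret / laiRobbins T σ (gap μ) := by
  rw [le_div_iff₀ (laiRobbins_pos hℓ hσ ha), laiRobbins_eq_sum hσ hγ2, X.regret_eq_sum_filter,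
    Finset.mul_sum]
  refine Finset.sum_le_sum fun c hc => ?_
  have hc' := (Finset.mem_filter.mp hc).2
  have := mul_le_mul_of_nonneg_left (h c hc') hc'.le
  linarith

theorem ratio_le (hℓ : 0 < Real.log T) (hσ : 0 < σ) (hγ2 : γ ^ 2 = 2 * Real.log T)
    {a : Fin K} (ha : 0 < gap μ a) {r : ℝ} (h : ∀ c, 0 < gap μ c →
      ∫ ω, (X.count c T ω : ℝ) ∂X.P ≤ γ ^ 2 / (gap μ c / σ) ^ 2 * r) :
    X.regret / laiRobbins T σ (gap μ) ≤ r := by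
  rw [div_le_iff₀ (laiRobbins_pos hℓ hσ ha), laiRobbins_eq_sum hσ hγ2, X.regret_eq_sum_filter,
    Finset.mul_sum]
  refine Finset.sum_le_sum fun c hc => ?_
  have hc' := (Finset.mem_filter.mp hc).2
  have := mul_le_mul_of_nonneg_left (h c hc') hc'.le
  linarith

theorem prob_crossing_accuracy_le (hT : Real.exp 100 ≤ T) (hγ : 0 < γ)
    (hγ2 : γ ^ 2 = 2 * Real.log T) (a : Fin K) {s : ℝ} (hs : s ^ 2 = 1) :
    X.P.real (X.crossing a s fun n => (accuracy T * γ) * √(n : ℝ)) ≤ 3 / Real.log T := by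
  have hℓ := hundred_le_log hT
  refine (X.prob_crossing_sqrt_le a hs
    (mul_nonneg (accuracy_pos hT).le hγ.le)).trans ?_
  have he : (accuracy T * γ) ^ 2 / 4 = accuracy T ^ 2 * Real.log T / 2 := by
    rw [mul_pow, hγ2]; ring
  rw [he, exp_accuracy hT]
  calc _ ≤ 3 * Real.log T * (1 / Real.log T ^ 2) :=
        mul_le_mul_of_nonneg_right (natLog_add_one_le hT) (by positivity)
    _ = _ := by field_simp

theorem prob_iUnion_crossing_le (hKT : K ≤ T) (hT : Real.exp 100 ≤ T) (hγ : 0 < γ)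
    (hγ2 : γ ^ 2 = 2 * Real.log T) :
    X.P.real (⋃ b, X.crossing b 1 fun n => (2 * γ) * √(n : ℝ)) ≤ 6 / Real.log T := by
  have hℓ := hundred_le_log hT
  have hT' : (0 : ℝ) < T := (Real.exp_pos _).trans_le hT
  refine (measureReal_iUnion_fintype_le _).trans ?_
  have h1 : ∀ b : Fin K, X.P.real (X.crossing b 1 fun n => (2 * γ) * √(n : ℝ)) ≤
      3 * Real.log T * (1 / T ^ 2) := by
    intro b
    refine (X.prob_crossing_sqrt_le b (by norm_num) (by positivity)).trans ?_
    have he : Real.exp (-((2 * γ) ^ 2 / 4)) = 1 / (T : ℝ) ^ 2 := by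
      rw [mul_pow, hγ2, show -(2 ^ 2 * (2 * Real.log T) / 4) = -(Real.log T + Real.log T) by ring,
        Real.exp_neg, Real.exp_add, Real.exp_log hT', one_div, sq]
    rw [he]
    exact mul_le_mul_of_nonneg_right (natLog_add_one_le hT) (by positivity)
  -- The union over at most `T` arms, each of probability $O(\log T/T^2)$, leaves $O(\log T/T)$;
  -- this converts it to $O(1/\log T)$.
  have h2 : Real.log T ^ 2 / 2 ≤ T := by
    have := Real.quadratic_le_exp_of_nonneg (x := Real.log T) (by linarith)
    rw [Real.exp_log hT'] at this
    linarith
  calc _ ≤ ∑ _b : Fin K, 3 * Real.log T * (1 / (T : ℝ) ^ 2) := Finset.sum_le_sum fun b _ => h1 b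
    _ = K * (3 * Real.log T * (1 / (T : ℝ) ^ 2)) := by
        rw [Finset.sum_const, Finset.card_univ, Fintype.card_fin, nsmul_eq_mul]
    _ ≤ T * (3 * Real.log T * (1 / (T : ℝ) ^ 2)) := by
        refine mul_le_mul_of_nonneg_right (by exact_mod_cast hKT) (by positivity)
    _ = 3 * Real.log T / T := by field_simp
    _ ≤ 6 / Real.log T := by
        rw [div_le_div_iff₀ hT' (by linarith)]
        nlinarith

/-- Gaps of at least $L\sigma\sqrt{K\log T/T}$ give $\gamma^2/d^2\le2T/(L^2K)$ per arm, and
$1+23\delta\le13$. This upper bound is the input of the lower bound: it shows that the optimal arms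
get most rounds when `L` is large. -/
theorem sum_integral_count_le (hK : 0 < K) (hKT : K ≤ T) (hT : Real.exp 100 ≤ T) (hσ : 0 < σ)
    (hγ : 0 < γ) (hγ2 : γ ^ 2 = 2 * Real.log T) {L : ℝ} (hL : 0 < L)
    (hgap : ∀ c, 0 < gap μ c → L * √(K * Real.log T / T) ≤ gap μ c / σ) :
    ∑ c with 0 < gap μ c, ∫ ω, (X.count c T ω : ℝ) ∂X.P ≤ K + 26 * T / L ^ 2 := by
  have hℓ := hundred_le_log hT
  have hT' : (0 : ℝ) < T := (Real.exp_pos _).trans_le hT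
  have hK' : (0 : ℝ) < K := Nat.cast_pos.mpr hK
  obtain ⟨b, hb⟩ := exists_gap_eq_zero hK μ
  have h1 : ∀ c, 0 < gap μ c →
      ∫ ω, (X.count c T ω : ℝ) ∂X.P ≤ 1 + 26 * T / (L ^ 2 * K) := by
    intro c hc
    refine (X.integral_count_le hKT hT hσ hγ hγ2 hc hb).trans ?_
    have hδ := accuracy_le_half hT
    have h2 : L ^ 2 * (K * Real.log T / T) ≤ (gap μ c / σ) ^ 2 := by
      have := pow_le_pow_left₀ (by positivity) (hgap c hc) 2
      rwa [mul_pow, Real.sq_sqrt (by positivity)] at this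
    have h3 : γ ^ 2 / (gap μ c / σ) ^ 2 ≤ γ ^ 2 / (L ^ 2 * (K * Real.log T / T)) := by
      gcongr
    have h4 : γ ^ 2 / (L ^ 2 * (K * Real.log T / T)) = 2 * T / (L ^ 2 * K) := by
      rw [hγ2]; field_simp
    rw [h4] at h3
    have h5 : γ ^ 2 / (gap μ c / σ) ^ 2 * (1 + 23 * accuracy T) ≤
        2 * T / (L ^ 2 * K) * 13 :=
      mul_le_mul h3 (by linarith) (by linarith [accuracy_pos hT]) (by positivity)
    have h6 : 2 * T / (L ^ 2 * K) * 13 = 26 * T / (L ^ 2 * K) := by ring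
    linarith
  calc _ ≤ ∑ c with 0 < gap μ c, (1 + 26 * T / (L ^ 2 * K)) :=
        Finset.sum_le_sum fun c hc => h1 c (Finset.mem_filter.mp hc).2
    _ ≤ ∑ _c : Fin K, (1 + 26 * T / (L ^ 2 * K)) :=
        Finset.sum_le_sum_of_subset_of_nonneg (Finset.filter_subset _ _)
          fun _ _ _ => by positivity
    _ = _ := by
        rw [Finset.sum_const, Finset.card_univ, Fintype.card_fin, nsmul_eq_mul]
        field_simp

/-- Integration of `count_ge`. The constants are $11=9+2$ (rare events, factor $(1-\delta)^2$) and
$70=52+18$ (share of the suboptimal arms, factor $(1+9/L)^{-2}$). -/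
theorem le_integral_count (hK : 0 < K) (hKT : 4 * K ≤ T) (hT : Real.exp 100 ≤ T) (hσ : 0 < σ)
    (hγ : 0 < γ) (hγ2 : γ ^ 2 = 2 * Real.log T) {L : ℝ} (hL : 1 ≤ L)
    (hgap : ∀ c, 0 < gap μ c → L * √(K * Real.log T / T) ≤ gap μ c / σ)
    {a : Fin K} (ha : 0 < gap μ a) :
    γ ^ 2 / (gap μ a / σ) ^ 2 * (1 - (11 * accuracy T + 70 / L + 2 * (K / T))) ≤
      ∫ ω, (X.count a T ω : ℝ) ∂X.P := by
  have hℓ := hundred_le_log hT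
  have hT' : (0 : ℝ) < T := (Real.exp_pos _).trans_le hT
  have hL0 : 0 < L := by linarith
  set δ := accuracy T with hδdef
  have hδ0 : 0 < δ := accuracy_pos hT
  have hδ1 : δ ≤ 1 / 2 := accuracy_le_half hT
  set d := gap μ a / σ with hd
  have hd0 : 0 < d := div_pos ha hσ
  set E₂ := ⋃ b, X.crossing b 1 fun n => (2 * γ) * √(n : ℝ) with hE₂
  set E₃ := X.crossing a (-1) fun n => (δ * γ) * √(n : ℝ) with hE₃
  have hm2 : MeasurableSet E₂ := MeasurableSet.iUnion fun b => X.measurableSet_crossing _ _ _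
  have hm3 : MeasurableSet E₃ := X.measurableSet_crossing _ _ _
  have hpt := X.count_ge hK hKT (by linarith) hσ hγ hγ2 hL0 (δ := δ) (by linarith) ha
    (hgap a ha)
  set n₀ := ((1 - δ) * γ / (d * (1 + 9 / L))) ^ 2 with hn₀
  have hi1 : Integrable (fun ω => 2 / (T : ℝ) * ∑ c with 0 < gap μ c, (X.count c T ω : ℝ)) X.P :=
    (integrable_finsetSum _ fun c _ => X.integrable_count c T).const_mul _
  have hi2 := X.integrable_indicator_one hm2
  have hi3 := X.integrable_indicator_one hm3
  have hi4 : Integrable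
      (fun ω => 1 - 2 / (T : ℝ) * ∑ c with 0 < gap μ c, (X.count c T ω : ℝ)) X.P :=
    (integrable_const 1).sub hi1
  have hi5 : Integrable (fun ω => 1 - 2 / (T : ℝ) * ∑ c with 0 < gap μ c, (X.count c T ω : ℝ) -
      E₂.indicator (fun _ => (1 : ℝ)) ω) X.P := hi4.sub hi2
  have hint := integral_mono ((hi5.sub hi3).const_mul n₀) (X.integrable_count a T) hpt
  rw [integral_const_mul] at hint
  simp only [Pi.sub_apply] at hint
  rw [integral_sub hi5 hi3, integral_sub hi4 hi2, integral_sub (integrable_const _) hi1,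
    integral_const_mul, integral_finsetSum _ fun c _ => X.integrable_count c T,
    X.integral_indicator_one_eq hm2, X.integral_indicator_one_eq hm3] at hint
  simp only [integral_const, probReal_univ, smul_eq_mul, mul_one] at hint
  have h1 := X.sum_integral_count_le hK (by omega) hT hσ hγ hγ2 hL0 hgap
  have h2 := X.prob_iUnion_crossing_le (by omega) hT hγ hγ2
  have h3 := X.prob_crossing_accuracy_le hT hγ hγ2 a (s := -1) (by norm_num)
  have hacc := inv_log_le_accuracy hT
  rw [← hδdef] at hacc h3
  rw [← hE₂] at h2
  rw [← hE₃] at h3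
  set S := ∑ c with 0 < gap μ c, ∫ ω, (X.count c T ω : ℝ) ∂X.P with hS
  have hS0 : 0 ≤ S :=
    Finset.sum_nonneg fun c _ => integral_nonneg fun ω => Nat.cast_nonneg _
  have h4 : 2 / (T : ℝ) * S ≤ 2 * (K / T) + 52 / L := by
    calc 2 / (T : ℝ) * S ≤ 2 / T * (K + 26 * T / L ^ 2) :=
          mul_le_mul_of_nonneg_left h1 (by positivity)
      _ = 2 * (K / T) + 52 / L ^ 2 := by field_simp; ring
      _ ≤ _ := by
          have : 52 / L ^ 2 ≤ 52 / L := by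
            gcongr
            nlinarith
          linarith
  have h5 : 6 / Real.log T = 6 * (1 / Real.log T) := by ring
  have h6 : 3 / Real.log T = 3 * (1 / Real.log T) := by ring
  set Z := 1 - 2 / (T : ℝ) * S - X.P.real E₂ - X.P.real E₃ with hZ
  have hZ1 : Z ≤ 1 := by
    have e1 : 0 ≤ 2 / (T : ℝ) * S := by positivity
    have e2 : 0 ≤ X.P.real E₂ := measureReal_nonneg
    have e3 : 0 ≤ X.P.real E₃ := measureReal_nonneg
    linarith
  have hZ2 : 1 - (2 * (K / T) + 52 / L + 9 * δ) ≤ Z := by linarith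
  have hABZ := one_sub_le_mul (q' := 11 * δ + 70 / L + 2 * (K / T)) hδ0 hδ1 hL0
    (by ring) hZ1 hZ2
  have hn : n₀ = γ ^ 2 / d ^ 2 * ((1 - δ) ^ 2 * (1 / (1 + 9 / L) ^ 2)) := by
    rw [hn₀]; field_simp
  have hg : 0 ≤ γ ^ 2 / d ^ 2 := by positivity
  calc _ ≤ γ ^ 2 / d ^ 2 * ((1 - δ) ^ 2 * (1 / (1 + 9 / L) ^ 2) * Z) :=
        mul_le_mul_of_nonneg_left hABZ hg
    _ = n₀ * Z := by rw [hn, mul_assoc (γ ^ 2 / d ^ 2)]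
    _ ≤ _ := hint

/-- The Lai–Robbins formula with explicit error terms. -/
theorem abs_ratio_sub_one_le (hK : 0 < K) (hKT : 4 * K ≤ T) (hT : Real.exp 100 ≤ T)
    (hσ : 0 < σ) (hγ : 0 < γ) (hγ2 : γ ^ 2 = 2 * Real.log T) {L η : ℝ} (hL : 1 ≤ L)
    (hη0 : 0 ≤ η) (hη : η ≤ 1) (hgap : ∀ c, 0 < gap μ c →
      gap μ c / σ ∈ Set.Icc (L * √(K * Real.log T / T)) (η * √(Real.log T)))
    {a : Fin K} (ha : 0 < gap μ a) :
    |X.regret / laiRobbins T σ (gap μ) - 1| ≤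
      70 * (1 / L) + 23 * accuracy T + 2 * (K / T) + η := by
  have hℓ := hundred_le_log hT
  have hδ := accuracy_pos hT
  have hL0 : 0 < 1 / L := by positivity
  have hKT0 : 0 ≤ (K : ℝ) / T := by positivity
  have hlo := X.le_ratio (by linarith) hσ hγ2 ha fun c hc =>
    X.le_integral_count hK hKT hT hσ hγ hγ2 hL (fun c hc => (hgap c hc).1) hc
  obtain ⟨b, hb⟩ := exists_gap_eq_zero hK μ
  have hhi := X.ratio_le (by linarith) hσ hγ2 ha (r := 1 + 23 * accuracy T + η) fun c hc => by
    refine (X.integral_count_le (by omega) hT hσ hγ hγ2 hc hb).trans ?_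
    have hd0 : 0 < gap μ c / σ := div_pos hc hσ
    have h1 := pow_le_pow_left₀ hd0.le (hgap c hc).2 2
    rw [mul_pow, Real.sq_sqrt (by linarith)] at h1
    -- The additive 1 in the bound on the pulls is negligible only for gaps that are not too large;
    -- this is the origin of the error term `η`.
    have h2 : 1 ≤ γ ^ 2 / (gap μ c / σ) ^ 2 * η := by
      rw [div_mul_eq_mul_div, le_div_iff₀ (by positivity), one_mul, hγ2]
      refine h1.trans ?_
      nlinarith [mul_nonneg hη0 (by linarith : (0 : ℝ) ≤ Real.log T),
        mul_nonneg (mul_nonneg hη0 (by linarith : (0 : ℝ) ≤ Real.log T)) (sub_nonneg.mpr hη)]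
    linarith
  rw [abs_le]
  have e : 70 / L = 70 * (1 / L) := by ring
  rw [e] at hlo
  constructor <;> linarith

theorem regret_le {D : ℝ} (hD : ∀ a, gap μ a ≤ D) : X.regret ≤ T * D := by
  rw [X.regret_eq]
  calc _ ≤ ∑ a, D * ∫ ω, (X.count a T ω : ℝ) ∂X.P :=
        Finset.sum_le_sum fun a _ => mul_le_mul_of_nonneg_right (hD a)
          (integral_nonneg fun ω => Nat.cast_nonneg _)
    _ = D * ∫ ω, ∑ a, (X.count a T ω : ℝ) ∂X.P := by
        rw [← Finset.mul_sum, integral_finsetSum _ fun a _ => X.integrable_count a T]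
    _ = D * T := by
        have : ∀ ω, ∑ a, (X.count a T ω : ℝ) = T := fun ω => by exact_mod_cast X.sum_count ω
        simp_rw [this]
        simp
    _ = T * D := mul_comm _ _

end UCB1Run

theorem exists_pos_of_mem_gapClass {T K : ℕ} {σ η L : ℝ} {Δ : Fin K → ℝ}
    (h : Δ ∈ gapClass T K σ η L) : ∃ a, 0 < Δ a := by
  obtain ⟨h1, -, h2, -⟩ := h
  obtain ⟨a, ha⟩ := Function.ne_iff.mp h2
  exact ⟨a, lt_of_le_of_ne (h1 a) (Ne.symm ha)⟩

theorem two_le_of_mem_gapClass {T K : ℕ} {σ η L : ℝ} {Δ : Fin K → ℝ}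
    (h : Δ ∈ gapClass T K σ η L) : 2 ≤ K := by
  obtain ⟨a, ha⟩ := exists_pos_of_mem_gapClass h
  obtain ⟨b, -, hb⟩ := Set.exists_of_ssubset h.2.1
  rw [Function.mem_support, not_not] at hb
  have hab : a ≠ b := by rintro rfl; linarith
  by_contra hK
  have ha' := a.2
  have hb' := b.2
  exact hab (Fin.ext (by omega))

theorem sqrt_two_mul_sq {x : ℝ} (h : 0 < x) : √(2 * x) ^ 2 = 2 * x :=
  Real.sq_sqrt (by linarith)

theorem exp_hundred_le_of_ratio_le {T K : ℕ} (hT : 0 < T)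
    (h : (K : ℝ) / T ≤ 1 / Real.exp 100) : Real.exp 100 * K ≤ T := by
  rwa [div_le_div_iff₀ (Nat.cast_pos.mpr hT) (Real.exp_pos _), one_mul, mul_comm] at h

theorem exp_hundred_ge : (101 : ℝ) ≤ Real.exp 100 := by
  linarith [Real.add_one_le_exp (100 : ℝ)]

/-- The constant `Real.exp 100` plays two roles: with $K\ge2$ it forces $\log T\ge100$, and it
dominates the explicit coefficients 70, 46, 2 and 1. -/
theorem laiRobbinsWithin_of_large_gaps {T K : ℕ} {σ η L : ℝ} (hT : 0 < T) (hσ : 0 < σ)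
    (hη0 : 0 < η) (hη : η ≤ 1) (hKT : (K : ℝ) / T ≤ 1 / Real.exp 100)
    (hL : Real.exp 100 < L) :
    LaiRobbinsWithin.{u} T K σ η L (Real.exp 100 *
      (1 / L + (√(Real.log (Real.log T) / Real.log T) + (K : ℝ) / T) + η)) := by
  rintro Δ hΔ μ rfl X
  have hK := two_le_of_mem_gapClass hΔ
  obtain ⟨a, ha⟩ := exists_pos_of_mem_gapClass hΔ
  have hC := exp_hundred_ge
  have hK' : (2 : ℝ) ≤ K := by exact_mod_cast hK
  have h1 := exp_hundred_le_of_ratio_le hT hKT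
  have hT100 : Real.exp 100 ≤ T := by nlinarith
  have h4 : 4 * K ≤ T := by
    have : (4 : ℝ) * K ≤ T := by nlinarith
    exact_mod_cast this
  have hℓ := hundred_le_log hT100
  have hL0 : 0 < L := by linarith
  refine (X.abs_ratio_sub_one_le (by omega) h4 hT100 hσ (Real.sqrt_pos.mpr (by linarith))
    (sqrt_two_mul_sq (by linarith)) (by linarith) hη0.le hη hΔ.2.2.2 ha).trans ?_
  rw [accuracy]
  have e1 : 0 ≤ 1 / L := by positivity
  have e2 := Real.sqrt_nonneg (Real.log (Real.log T) / Real.log T)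
  have e3 : 0 ≤ (K : ℝ) / T := by positivity
  nlinarith [mul_nonneg e1 (sub_nonneg.mpr hC), mul_nonneg e2 (sub_nonneg.mpr hC),
    mul_nonneg e3 (sub_nonneg.mpr hC), mul_nonneg hη0.le (sub_nonneg.mpr hC)]

/-- The gap vector of the class whose ratio of regrets is small. -/
theorem exists_small_ratio {T K : ℕ} {σ η ε : ℝ} (hT : 0 < T) (hσ : 0 < σ)
    (hKT : (K : ℝ) / T ≤ 1 / Real.exp 100) (hK : 2 ≤ K) (hε : 0 < ε)
    (hεη : ε * √((K : ℝ) / T) ≤ η) :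
    ∃ Δ ∈ gapClass T K σ η ε, ∀ μ : Fin K → ℝ, gap μ = Δ →
      ∀ X : UCB1Run.{u} T K μ σ (√(2 * Real.log T)),
        X.regret / laiRobbins T σ Δ ≤ ε ^ 2 := by
  have hC := exp_hundred_ge
  have hK' : (2 : ℝ) ≤ K := by exact_mod_cast hK
  have h1 := exp_hundred_le_of_ratio_le hT hKT
  have hT100 : Real.exp 100 ≤ T := by nlinarith
  have hℓ := hundred_le_log hT100
  have hℓ0 : 0 < Real.log T := by linarith
  have hT' : (0 : ℝ) < T := Nat.cast_pos.mpr hT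
  have hK0 : (0 : ℝ) < K := by linarith
  -- The smallest gap allowed in the class, given to all arms but one.
  set D := σ * (ε * √(K * Real.log T / T)) with hD
  have hD0 : 0 < D := by positivity
  have hDσ : D / σ = ε * √(K * Real.log T / T) := by rw [hD]; field_simp
  have : NeZero K := ⟨by omega⟩
  set z : Fin K := 0
  set o : Fin K := ⟨1, by omega⟩ with ho
  have hoz : o ≠ z := fun h => by simpa [o, z] using congrArg Fin.val h
  refine ⟨fun a => if a = z then 0 else D, ⟨fun a => ?_, ?_, ?_, fun a ha => ?_⟩,
    fun μ hμ X => ?_⟩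
  · simp only; split_ifs <;> linarith
  · rw [Set.ssubset_univ_iff, Set.ne_univ_iff_exists_notMem]
    exact ⟨z, by simp⟩
  · exact Function.ne_iff.mpr ⟨o, by simp [hoz, hD0.ne']⟩
  · have haz : a ≠ z := by rintro rfl; simp at ha
    simp only [haz, if_false]
    rw [hDσ]
    refine ⟨le_rfl, ?_⟩
    have : √(K * Real.log T / T) = √((K : ℝ) / T) * √(Real.log T) := by
      rw [← Real.sqrt_mul (by positivity)]; congr 1; ring
    rw [this, ← mul_assoc]
    exact mul_le_mul_of_nonneg_right hεη (Real.sqrt_nonneg _)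
  · have hpos : 0 < (fun a : Fin K => if a = z then 0 else D) o := by simp [hoz, hD0]
    rw [div_le_iff₀ (laiRobbins_pos hℓ0 hσ hpos)]
    have hreg := X.regret_le (D := D) fun a => by
      rw [hμ]; simp only; split_ifs <;> linarith
    refine hreg.trans ?_
    have hfil : (Finset.univ.filter fun a : Fin K => 0 < if a = z then 0 else D) =
        Finset.univ.erase z := by
      ext a
      by_cases h : a = z <;> simp [h, hD0]
    have hsum : ∑ a with 0 < (if a = z then 0 else D),
        σ ^ 2 / (if a = z then 0 else D) = (K - 1) * (σ ^ 2 / D) := by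
      rw [hfil, Finset.sum_congr rfl (g := fun _ => σ ^ 2 / D)
        (fun a ha => by rw [if_neg (Finset.ne_of_mem_erase ha)])]
      rw [Finset.sum_const, Finset.card_erase_of_mem (Finset.mem_univ _), Finset.card_univ,
        Fintype.card_fin, nsmul_eq_mul, Nat.cast_sub (by omega)]
      simp
    rw [laiRobbins, hsum]
    have hD2 : D ^ 2 = σ ^ 2 * ε ^ 2 * (K * Real.log T / T) := by
      rw [hD, mul_pow, mul_pow, Real.sq_sqrt (by positivity)]; ring
    have : ε ^ 2 * (2 * Real.log T * ((K - 1) * (σ ^ 2 / D))) =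
        ε ^ 2 * (2 * Real.log T * (K - 1)) * σ ^ 2 / D := by ring
    rw [this, le_div_iff₀ hD0, mul_assoc, ← sq, hD2]
    have e1 : (T : ℝ) * (σ ^ 2 * ε ^ 2 * (K * Real.log T / T)) =
        ε ^ 2 * σ ^ 2 * Real.log T * K := by field_simp
    rw [e1]
    -- What remains is $K\le2(K-1)$.
    have e2 : 0 ≤ ε ^ 2 * σ ^ 2 * Real.log T := by positivity
    nlinarith [mul_nonneg e2 (by linarith : (0 : ℝ) ≤ K - 2)]

end Bandit

/-! ### Existence of UCB1 runs. -/

namespace Bandit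

theorem exists_measurable_argmax {Ω : Type*} {m : MeasurableSpace Ω} {K : ℕ} (hK : 0 < K)
    (f : Fin K → Ω → ℝ) (hf : ∀ b, Measurable (f b)) :
    ∃ g : Ω → Fin K, Measurable g ∧ ∀ ω b, f b ω ≤ f (g ω) ω := by
  classical
  suffices h : ∀ s : Finset (Fin K), ∃ g : Ω → Fin K, Measurable g ∧
      ∀ ω, ∀ b ∈ s, f b ω ≤ f (g ω) ω by
    obtain ⟨g, hg, h⟩ := h Finset.univ
    exact ⟨g, hg, fun ω b => h ω b (Finset.mem_univ b)⟩
  intro s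
  induction s using Finset.induction_on with
  | empty => exact ⟨fun _ => ⟨0, hK⟩, measurable_const, by simp⟩
  | insert c s _ ih =>
    obtain ⟨g, hg, h⟩ := ih
    have hfg : Measurable fun ω => f (g ω) ω := by
      have he : (fun ω => f (g ω) ω) = fun ω => ∑ b, if g ω = b then f b ω else 0 := by
        funext ω; simp
      rw [he]
      exact Finset.measurable_fun_sum _ fun b _ =>
        Measurable.ite (hg (measurableSet_singleton b)) (hf b) measurable_const
    refine ⟨fun ω => if f (g ω) ω ≤ f c ω then c else g ω,
      Measurable.ite (measurableSet_le hfg (hf c)) measurable_const hg, fun ω b hb => ?_⟩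
    simp only
    split_ifs with hle
    · rcases Finset.mem_insert.mp hb with rfl | hb
      · exact le_rfl
      · exact (h ω b hb).trans hle
    · rcases Finset.mem_insert.mp hb with rfl | hb
      · exact (not_le.mp hle).le
      · exact h ω b hb

section Existence

variable {Ω : Type u} {T K : ℕ} (μ : Fin K → ℝ) (σ γ : ℝ) (ξ : Fin T → Ω → ℝ)

theorem pullsBefore_congr {A A' : Fin T → Ω → Fin K} {t : Fin T} (h : ∀ s < t, A s = A' s)
    (a : Fin K) (ω : Ω) : pullsBefore A a t ω = pullsBefore A' a t ω := by
  refine Finset.filter_congr fun s hs => ?_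
  rw [h s (Finset.mem_Iio.mp hs)]

theorem ucbIndex_congr {A A' : Fin T → Ω → Fin K} {t : Fin T} (h : ∀ s < t, A s = A' s)
    (a : Fin K) (ω : Ω) : ucbIndex μ σ γ ξ A a t ω = ucbIndex μ σ γ ξ A' a t ω := by
  have hsum : ∑ s ∈ pullsBefore A' a t ω, reward μ σ ξ A s ω =
      ∑ s ∈ pullsBefore A' a t ω, reward μ σ ξ A' s ω := by
    refine Finset.sum_congr rfl fun s hs => ?_
    rw [reward, reward, h s (Finset.mem_Iio.mp (Finset.mem_filter.mp hs).1)]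
  rw [ucbIndex, ucbIndex, empMean, empMean, numPulls, numPulls, pullsBefore_congr h, hsum]

theorem pastRewards_congr {A A' : Fin T → Ω → Fin K} {t : Fin T} (h : ∀ s < t, A s = A' s) :
    pastRewards μ σ ξ A t = pastRewards μ σ ξ A' t := by
  refine iSup_congr fun s => iSup_congr fun hs => ?_
  congr 1
  funext ω
  rw [reward, reward, h s hs]

theorem pastRewards_mono (A : Fin T → Ω → Fin K) {s t : Fin T} (h : s ≤ t) :
    pastRewards μ σ ξ A s ≤ pastRewards μ σ ξ A t :=
  biSup_mono fun _ hr => lt_of_lt_of_le hr h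

theorem measurable_reward_pastRewards (A : Fin T → Ω → Fin K) {s t : Fin T} (h : s < t) :
    Measurable[pastRewards μ σ ξ A t] (reward μ σ ξ A s) :=
  (comap_measurable (reward μ σ ξ A s)).mono
    (le_iSup₂_of_le (f := fun s (_ : s ∈ Set.Iio t) =>
      MeasurableSpace.comap (reward μ σ ξ A s) inferInstance) s h le_rfl) le_rfl

theorem measurable_ucbIndex (A : Fin T → Ω → Fin K) (t : Fin T)
    (h : ∀ s < t, Measurable[pastRewards μ σ ξ A t] (A s)) (b : Fin K) :
    Measurable[pastRewards μ σ ξ A t] (ucbIndex μ σ γ ξ A b t) := by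
  have hset : ∀ s < t, MeasurableSet[pastRewards μ σ ξ A t] {ω | A s ω = b} :=
    fun s hs => h s hs (measurableSet_singleton b)
  have h1 : Measurable[pastRewards μ σ ξ A t] fun ω => (numPulls A b t ω : ℝ) := by
    have he : (fun ω => (numPulls A b t ω : ℝ)) =
        fun ω => ∑ s ∈ Finset.Iio t, if A s ω = b then (1 : ℝ) else 0 := by
      funext ω; simp [numPulls, pullsBefore]
    rw [he]
    exact Finset.measurable_fun_sum _ fun s hs =>
      Measurable.ite (hset s (Finset.mem_Iio.mp hs)) measurable_const measurable_const
  have h2 : Measurable[pastRewards μ σ ξ A t]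
      fun ω => ∑ s ∈ pullsBefore A b t ω, reward μ σ ξ A s ω := by
    have he : (fun ω => ∑ s ∈ pullsBefore A b t ω, reward μ σ ξ A s ω) =
        fun ω => ∑ s ∈ Finset.Iio t, if A s ω = b then reward μ σ ξ A s ω else 0 := by
      funext ω; rw [pullsBefore, Finset.sum_filter]
    rw [he]
    exact Finset.measurable_fun_sum _ fun s hs =>
      Measurable.ite (hset s (Finset.mem_Iio.mp hs))
        (measurable_reward_pastRewards μ σ ξ A (Finset.mem_Iio.mp hs)) measurable_const
  exact (h2.div h1).add (measurable_const.div (Real.continuous_sqrt.measurable.comp h1))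

/-- Rounds are fixed one at a time. Indices and past rewards at a round depend only on strictly
earlier arms, so redefining the arm of round `k` disturbs neither the rounds before it nor its own
index. -/
theorem exists_ucb_arms (hK : 0 < K) (k : ℕ) :
    ∃ A : Fin T → Ω → Fin K, ∀ t : Fin T, (t : ℕ) < k →
      Measurable[pastRewards μ σ ξ A t] (A t) ∧ ((t : ℕ) < K → ∀ ω, (A t ω : ℕ) = t) ∧
      (K ≤ (t : ℕ) → ∀ ω b, ucbIndex μ σ γ ξ A b t ω ≤ ucbIndex μ σ γ ξ A (A t ω) t ω) := by
  induction k with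
  | zero => exact ⟨fun _ _ => ⟨0, hK⟩, fun t ht => absurd ht (Nat.not_lt_zero _)⟩
  | succ k ih =>
    obtain ⟨A, hA⟩ := ih
    by_cases hkT : k < T
    swap
    · exact ⟨A, fun t _ => hA t (by omega)⟩
    set τ : Fin T := ⟨k, hkT⟩ with hτ
    have hpast : ∀ s < τ, Measurable[pastRewards μ σ ξ A τ] (A s) := fun s hs =>
      (hA s hs).1.mono (pastRewards_mono μ σ ξ A hs.le) le_rfl
    obtain ⟨g, hgm, hginit, hgstep⟩ : ∃ g : Ω → Fin K, Measurable[pastRewards μ σ ξ A τ] g ∧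
        (k < K → ∀ ω, (g ω : ℕ) = k) ∧ (K ≤ k → ∀ ω b,
          ucbIndex μ σ γ ξ A b τ ω ≤ ucbIndex μ σ γ ξ A (g ω) τ ω) := by
      by_cases hk : k < K
      · exact ⟨fun _ => ⟨k, hk⟩, measurable_const, fun _ _ => rfl, fun h => absurd hk (by omega)⟩
      · obtain ⟨g, hg1, hg2⟩ := exists_measurable_argmax (m := pastRewards μ σ ξ A τ) hK
          (fun b => ucbIndex μ σ γ ξ A b τ)
          (fun b => measurable_ucbIndex μ σ γ ξ A τ hpast b)
        exact ⟨g, hg1, fun h => absurd h hk, fun _ => hg2⟩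
    refine ⟨Function.update A τ g, fun t ht => ?_⟩
    have hagree : ∀ s < t, Function.update A τ g s = A s := by
      intro s hs
      refine Function.update_of_ne ?_ _ _
      rintro rfl
      have : k < (t : ℕ) := hs
      omega
    rw [pastRewards_congr μ σ ξ hagree]
    simp_rw [fun b ω => ucbIndex_congr μ σ γ ξ hagree b ω]
    by_cases h : t = τ
    · subst h
      rw [Function.update_self]
      exact ⟨hgm, hginit, hgstep⟩
    · rw [Function.update_of_ne h]
      have : (t : ℕ) ≠ k := fun h' => h (Fin.ext h')
      exact hA t (by omega)

end Existence

/-- `LaiRobbinsWithin` quantifies over all runs and would be vacuous without one; the converse in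
the third claim needs an actual run. The canonical product space is lifted to the required universe.
-/
theorem nonempty_ucb1Run {T K : ℕ} (hK : 0 < K) (μ : Fin K → ℝ) (σ γ : ℝ) :
    Nonempty (UCB1Run.{u} T K μ σ γ) := by
  set ν : Measure (Fin T → ℝ) := Measure.pi fun _ => gaussianReal 0 1 with hν
  set P : Measure (ULift.{u} (Fin T → ℝ)) := ν.map ULift.up with hP
  have hPp : IsProbabilityMeasure P :=
    Measure.isProbabilityMeasure_map measurable_up.aemeasurable
  set ξ : Fin T → ULift.{u} (Fin T → ℝ) → ℝ := fun t ω => ω.down t with hξ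
  have hξm : ∀ t, Measurable (ξ t) := fun t => (measurable_pi_apply t).comp measurable_down
  have hdown : P.map (fun ω t => ξ t ω) = ν := by
    have h1 : Measurable fun (ω : ULift.{u} (Fin T → ℝ)) t => ξ t ω := measurable_down
    rw [hP, Measure.map_map h1 measurable_up]
    exact Measure.map_id
  have hlaw : ∀ t, P.map (ξ t) = gaussianReal 0 1 := by
    intro t
    have h2 : ξ t = (fun x : Fin T → ℝ => x t) ∘ fun ω t => ξ t ω := rfl
    rw [h2, ← Measure.map_map (measurable_pi_apply t) measurable_down, hdown, hν]
    exact (measurePreserving_eval _ t).map_eq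
  obtain ⟨A, hA⟩ := exists_ucb_arms μ σ γ ξ hK T
  exact ⟨{
    Ω := ULift.{u} (Fin T → ℝ)
    mΩ := inferInstance
    P := P
    isProb := hPp
    ξ := ξ
    ξ_meas := hξm
    ξ_indep := by
      rw [iIndepFun_iff_map_fun_eq_pi_map fun t => (hξm t).aemeasurable, hdown]
      simp_rw [hlaw]
      exact hν
    ξ_law := hlaw
    A := A
    A_adapted := fun t => (hA t t.2).1
    A_init := fun ω s hs t ht hst => by
      have h1 := (hA s s.2).2.1 hs ω
      have h2 := (hA t t.2).2.1 ht ω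
      have h3 : A s ω = A t ω := hst
      exact Fin.ext (by rw [← h1, ← h2, h3])
    A_step := fun t ht ω b => (hA t t.2).2.2 ht ω b }⟩

end Bandit

/-! ### A single suboptimal arm: the ratio stays away from one for bounded `L`. -/

namespace Bandit

theorem sum_errors_le {δ r x : ℝ} (hδ0 : 0 < δ) (hδ1 : δ ≤ 1 / 2) (hr1 : r ≤ 1) (hr0 : 0 ≤ r)
    (hx : 0 ≤ x) : x / 2 + (1 + δ) ^ 2 * r + δ * r + 4 * (1 + δ) ^ 2 * (6 * δ) + 4 * δ + δ ≤
      r + 70 * δ + x := by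
  have hδ2 : (1 + δ) ^ 2 ≤ 1 + 3 * δ := by nlinarith
  have f1 : (1 + δ) ^ 2 * r ≤ r + 3 * δ := by
    nlinarith [mul_le_mul_of_nonneg_right hδ2 hr0, mul_le_mul_of_nonneg_left hr1 hδ0.le]
  have f2 : δ * r ≤ δ := mul_le_of_le_one_right hδ0.le hr1
  have f3 : 4 * (1 + δ) ^ 2 * (6 * δ) ≤ 60 * δ := by
    have : (1 + δ) ^ 2 ≤ 5 / 2 := by linarith
    nlinarith [mul_le_mul_of_nonneg_right this hδ0.le]
  linarith

attribute [local instance] UCB1Run.mΩ UCB1Run.isProb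

namespace UCB1Run

variable {T K : ℕ} {μ : Fin K → ℝ} {σ γ : ℝ} (X : UCB1Run.{u} T K μ σ γ)

/-- With a single suboptimal arm, the optimal arms have large indices since they share the rounds:
a pathwise bound for the number of pulls of the suboptimal arm. -/
theorem count_le_of_many_optimal (hK : 2 ≤ K) (hKT : K ≤ T) (hσ : 0 < σ) (hγ : 0 < γ)
    (hγ2 : γ ^ 2 = 2 * Real.log T) (hℓ : 0 < Real.log T) {L d D δ : ℝ} (hL : 0 < L) {a b₀ : Fin K}
    (hd : gap μ a / σ = d) (hb₀ : b₀ ≠ a) (hgap : ∀ b, b ≠ a → gap μ b = 0)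
    (hdL : d = L * √(K * Real.log T / T)) (hD : D = d * (1 + 1 / (3 * L))) (ω : X.Ω) :
    (X.count a T ω : ℝ) ≤ 1 + ((1 + δ) * γ / D) ^ 2 +
      ∑ n ∈ Finset.Ico 1 (T + 1) with ((1 + δ) * γ / D) ^ 2 < ((n : ℕ) : ℝ),
        (X.reach a 1 n (D * n - γ * √(n : ℝ))).indicator (fun _ => (1 : ℝ)) ω +
      ((1 + δ) * γ / (d / 2)) ^ 2 * (2 / (K - 1) * ∑ b ∈ Finset.univ.erase a,
        (X.crossing b (-1) fun n => (γ / 2) * √(n : ℝ)).indicator (fun _ => (1 : ℝ)) ω) +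
      ∑ n ∈ Finset.Ico 1 (T + 1) with ((1 + δ) * γ / (d / 2)) ^ 2 < ((n : ℕ) : ℝ),
        (X.reach a 1 n (d / 2 * n - γ * √(n : ℝ))).indicator (fun _ => (1 : ℝ)) ω +
      T * (X.crossing b₀ (-1) fun n => γ * √(n : ℝ) + (d / 2) * n).indicator
        (fun _ => (1 : ℝ)) ω := by
  classical
  have hT' : (0 : ℝ) < T := Nat.cast_pos.mpr (by omega)
  have hK' : (2 : ℝ) ≤ K := by exact_mod_cast hK
  have hind : ∀ (s : Set X.Ω), 0 ≤ s.indicator (fun _ => (1 : ℝ)) ω :=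
    fun s => Set.indicator_nonneg (fun _ _ => zero_le_one) ω
  set F := X.crossing b₀ (-1) fun n => γ * √(n : ℝ) + (d / 2) * n with hF
  set G : Fin K → Set X.Ω := fun b => X.crossing b (-1) fun n => (γ / 2) * √(n : ℝ) with hG
  set Q₁ : ℕ → Set X.Ω := fun n => X.reach a 1 n (D * n - γ * √(n : ℝ)) with hQ₁
  set Q₂ : ℕ → Set X.Ω := fun n => X.reach a 1 n (d / 2 * n - γ * √(n : ℝ)) with hQ₂
  set m₁ := ((1 + δ) * γ / D) ^ 2 with hm₁
  set m₂ := ((1 + δ) * γ / (d / 2)) ^ 2 with hm₂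
  have hm₁0 : 0 ≤ m₁ := sq_nonneg _
  have hm₂0 : 0 ≤ m₂ := sq_nonneg _
  have hS₁ : 0 ≤ ∑ n ∈ Finset.Ico 1 (T + 1) with m₁ < ((n : ℕ) : ℝ),
      (Q₁ n).indicator (fun _ => (1 : ℝ)) ω := Finset.sum_nonneg fun n _ => hind _
  have hS₂ : 0 ≤ ∑ n ∈ Finset.Ico 1 (T + 1) with m₂ < ((n : ℕ) : ℝ),
      (Q₂ n).indicator (fun _ => (1 : ℝ)) ω := Finset.sum_nonneg fun n _ => hind _
  have hg0 : 0 ≤ ∑ b ∈ Finset.univ.erase a, (G b).indicator (fun _ => (1 : ℝ)) ω :=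
    Finset.sum_nonneg fun n _ => hind _
  have hK1 : (0 : ℝ) < K - 1 := by linarith
  have hg1 : 0 ≤ m₂ * (2 / (K - 1) * ∑ b ∈ Finset.univ.erase a,
      (G b).indicator (fun _ => (1 : ℝ)) ω) :=
    mul_nonneg hm₂0 (mul_nonneg (div_nonneg (by norm_num) hK1.le) hg0)
  have hF0 : 0 ≤ T * F.indicator (fun _ => (1 : ℝ)) ω := mul_nonneg hT'.le (hind F)
  by_cases hωF : ω ∈ F
  · have h1 : (X.count a T ω : ℝ) ≤ T := by exact_mod_cast X.count_le a T ω
    rw [Set.indicator_of_mem hωF]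
    linarith
  -- At least half of the optimal arms are unlucky. Only their fraction matters, so no union bound
  -- over the arms is paid. In this case the cruder gap `d / 2`, guaranteed by `b₀`, is used.
  by_cases hωG : 1 ≤ 2 / ((K : ℝ) - 1) * ∑ b ∈ Finset.univ.erase a,
      (G b).indicator (fun _ => (1 : ℝ)) ω
  · have h1 := X.count_le_of_forall a ω hm₂0 Q₂ fun t hA h1 => Or.inr
      (X.reach_of_not_crossing hKT hσ hA h1
        (X.index_ge_of_notMem_crossing hKT (X.le_of_one_le_count hA h1) hωF)
        (by rw [hgap b₀ hb₀, sub_zero, hd]; ring))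
    have h2 := le_mul_of_one_le_right hm₂0 hωG
    linarith
  rw [not_le] at hωG
  -- Fewer than half of the optimal arms are unlucky, and at most half can have more than twice the
  -- average share $T/(K-1)$.
  have hexists : ∃ b, b ≠ a ∧ ω ∉ G b ∧ (X.count b T ω : ℝ) ≤ 2 * T / (K - 1) := by
    by_contra hcon
    push Not at hcon
    have h1 : ∀ b ∈ Finset.univ.erase a, (1 : ℝ) ≤ (G b).indicator (fun _ => (1 : ℝ)) ω +
        (K - 1) / (2 * T) * X.count b T ω := by
      intro b hb
      have h0 : 0 ≤ (K - 1) / (2 * (T : ℝ)) * X.count b T ω := by positivity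
      by_cases hbG : ω ∈ G b
      · rw [Set.indicator_of_mem hbG]; linarith
      · have h2 := hcon b (Finset.ne_of_mem_erase hb) hbG
        have h3 := hind (G b)
        have h4 : (1 : ℝ) ≤ (K - 1) / (2 * (T : ℝ)) * X.count b T ω := by
          calc (1 : ℝ) = (K - 1) / (2 * (T : ℝ)) * (2 * T / (K - 1)) := by field_simp
            _ ≤ _ := mul_le_mul_of_nonneg_left h2.le (by positivity)
        linarith
    have h2 := Finset.sum_le_sum h1
    rw [Finset.sum_add_distrib, ← Finset.mul_sum, Finset.sum_const,
      Finset.card_erase_of_mem (Finset.mem_univ _), Finset.card_univ, Fintype.card_fin,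
      nsmul_eq_mul, mul_one, Nat.cast_sub (by omega), Nat.cast_one] at h2
    have h3 : ∑ b ∈ Finset.univ.erase a, (X.count b T ω : ℝ) ≤ T := by
      calc _ ≤ ∑ b, (X.count b T ω : ℝ) :=
            Finset.sum_le_sum_of_subset_of_nonneg (Finset.subset_univ _)
              fun _ _ _ => Nat.cast_nonneg _
        _ = T := by exact_mod_cast X.sum_count ω
    have h4 : (K - 1) / (2 * (T : ℝ)) * ∑ b ∈ Finset.univ.erase a, (X.count b T ω : ℝ) ≤
        (K - 1) / 2 := by
      calc _ ≤ (K - 1) / (2 * (T : ℝ)) * T := mul_le_mul_of_nonneg_left h3 (by positivity)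
        _ = _ := by field_simp
    rw [div_mul_eq_mul_div, div_lt_one hK1] at hωG
    linarith
  obtain ⟨b, hba, hbG, hbT⟩ := hexists
  have h1 := X.count_le_of_forall a ω hm₁0 Q₁ fun t hA h1 => by
    refine Or.inr (X.reach_of_not_crossing hKT hσ hA h1 (b := b) (c := d / (3 * L)) ?_ ?_)
    · have hN := X.one_le_count hKT b (X.le_of_one_le_count hA h1) ω
      have hN0 : (0 : ℝ) < X.count b t ω := Nat.cast_pos.mpr hN
      have hS : -(γ / 2 * √(X.count b t ω : ℝ)) ≤ X.noise b t ω := by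
        by_contra hlt
        refine hbG ⟨t, t.2.le, hN, ?_⟩
        simp only; linarith
      rw [le_index_iff hN]
      -- Half of the bonus pays for the noise of `b`; the other half must cover $d/(3L)=\sqrt{K\log
      -- T/T}/3$. The factor 3 works because $4K/9\le K-1$ for $K\ge2$.
      have h2 : d / (3 * L) * √(X.count b t ω : ℝ) ≤ γ / 2 := by
        have h3 : (X.count b t ω : ℝ) ≤ 2 * T / (K - 1) := by
          refine le_trans ?_ hbT
          exact_mod_cast X.count_mono b ω t.2.le
        have h4 : d / (3 * L) = √(K * Real.log T / T) / 3 := by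
          rw [hdL]; field_simp
        rw [h4]
        refine (pow_le_pow_iff_left₀ (by positivity) (by positivity) two_ne_zero).mp ?_
        rw [mul_pow, div_pow, div_pow, Real.sq_sqrt (by positivity), Real.sq_sqrt hN0.le, hγ2]
        calc K * Real.log T / T / 3 ^ 2 * X.count b t ω
            ≤ K * Real.log T / T / 3 ^ 2 * (2 * T / (K - 1)) :=
              mul_le_mul_of_nonneg_left h3 (by positivity)
          _ = (2 * K / 9) * Real.log T / (K - 1) := by field_simp; norm_num
          _ ≤ 2 * Real.log T / 2 ^ 2 := by
              rw [div_le_div_iff₀ hK1 (by norm_num)]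
              nlinarith [mul_nonneg (sub_nonneg.mpr hK') hℓ.le]
      have h5 := Real.mul_self_sqrt hN0.le
      have h6 := mul_le_mul_of_nonneg_right h2 (Real.sqrt_nonneg (X.count b t ω : ℝ))
      rw [mul_assoc, h5] at h6
      linarith
    · rw [hgap b hba, sub_zero, hd, hD]
      field_simp
  linarith

/-- With a single suboptimal arm of gap `L σ √(K log T / T)`, the ratio of regrets stays below
the value `(1 + 1 / (3 L))⁻²`. -/
theorem integral_count_le_of_many_optimal (hK : 2 ≤ K) (hKT : K ≤ T) (hT : Real.exp 100 ≤ T)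
    (hσ : 0 < σ) (hγ : 0 < γ) (hγ2 : γ ^ 2 = 2 * Real.log T) {L : ℝ} (hL : 0 < L) {a : Fin K}
    (hgap : ∀ b, b ≠ a → gap μ b = 0)
    (haL : gap μ a / σ = L * √(K * Real.log T / T)) :
    ∫ ω, (X.count a T ω : ℝ) ∂X.P ≤ γ ^ 2 / (gap μ a / σ) ^ 2 *
      (1 / (1 + 1 / (3 * L)) ^ 2 + 70 * accuracy T + L ^ 2 * (K / T)) := by
  classical
  have hℓ := hundred_le_log hT
  have hT' : (0 : ℝ) < T := (Real.exp_pos _).trans_le hT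
  have hK' : (2 : ℝ) ≤ K := by exact_mod_cast hK
  have hK1 : (0 : ℝ) < K - 1 := by linarith
  set d := gap μ a / σ with hd
  have hd0 : 0 < d := by rw [haL]; positivity
  set δ := accuracy T with hδdef
  have hδ0 : 0 < δ := accuracy_pos hT
  have hδ1 : δ ≤ 1 / 2 := accuracy_le_half hT
  set D := d * (1 + 1 / (3 * L)) with hD
  have hD0 : 0 < D := by positivity
  obtain ⟨b₀, hb₀⟩ : ∃ b₀, b₀ ≠ a := by
    have : Nontrivial (Fin K) := Fin.nontrivial_iff_two_le.mpr hK
    exact exists_ne a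
  have hpt := X.count_le_of_many_optimal hK hKT hσ hγ hγ2 (by linarith) (δ := δ) hL hd.symm hb₀
    hgap haL hD
  set F := X.crossing b₀ (-1) fun n => γ * √(n : ℝ) + (d / 2) * n with hF
  set m₁ := ((1 + δ) * γ / D) ^ 2 with hm₁
  set m₂ := ((1 + δ) * γ / (d / 2)) ^ 2 with hm₂
  have hFm : MeasurableSet F := X.measurableSet_crossing _ _ _
  have hRm : ∀ (x : ℝ) (n : ℕ), MeasurableSet (X.reach a 1 n (x * n - γ * √(n : ℝ))) :=
    fun x n => X.measurableSet_reach _ _ _ _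
  have hGm : ∀ b, MeasurableSet (X.crossing b (-1) fun n => (γ / 2) * √(n : ℝ)) :=
    fun b => X.measurableSet_crossing _ _ _
  have hi1 : ∀ m x : ℝ, Integrable (fun ω => ∑ n ∈ Finset.Ico 1 (T + 1) with m < ((n : ℕ) : ℝ),
      (X.reach a 1 n (x * n - γ * √(n : ℝ))).indicator (fun _ => (1 : ℝ)) ω) X.P :=
    fun m x => integrable_finsetSum _ fun n _ => X.integrable_indicator_one (hRm x n)
  have hi2 : Integrable (fun ω => m₂ * (2 / ((K : ℝ) - 1) * ∑ b ∈ Finset.univ.erase a,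
      (X.crossing b (-1) fun n => (γ / 2) * √(n : ℝ)).indicator (fun _ => (1 : ℝ)) ω)) X.P :=
    ((integrable_finsetSum _ fun b _ => X.integrable_indicator_one (hGm b)).const_mul _).const_mul _
  have hi3 : Integrable (fun ω => T * F.indicator (fun _ => (1 : ℝ)) ω) X.P :=
    (X.integrable_indicator_one hFm).const_mul _
  have hj1 := (integrable_const (μ := X.P) (1 + m₁)).add (hi1 m₁ D)
  have hj2 := hj1.add hi2
  have hj3 := hj2.add (hi1 m₂ (d / 2))
  have hint := integral_mono (X.integrable_count a T) (hj3.add hi3) hpt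
  rw [integral_add' hj3 hi3, integral_add' hj2 (hi1 m₂ (d / 2)), integral_add' hj1 hi2,
    integral_add' (integrable_const _) (hi1 m₁ D), integral_const_mul, integral_const_mul,
    integral_const_mul, integral_finsetSum _ fun b _ => X.integrable_indicator_one (hGm b),
    integral_finsetSum _ fun n _ => X.integrable_indicator_one (hRm D n),
    integral_finsetSum _ fun n _ => X.integrable_indicator_one (hRm (d / 2) n),
    X.integral_indicator_one_eq hFm] at hint
  simp_rw [fun x n => X.integral_indicator_one_eq (hRm x n),
    fun b => X.integral_indicator_one_eq (hGm b)] at hint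
  simp only [integral_const, probReal_univ, smul_eq_mul, one_mul] at hint
  have h1 := X.sum_prob_reach_accuracy_le hT hγ hγ2 a hD0
  have h2 := X.sum_prob_reach_accuracy_le hT hγ hγ2 a (half_pos hd0)
  have h3 := X.mul_prob_crossing_index_le (Nat.cast_pos.mp hT') hγ hγ2 b₀ (half_pos hd0)
  rw [← hδdef, ← hm₁] at h1
  rw [← hδdef, ← hm₂] at h2
  have hacc := inv_log_le_accuracy hT
  rw [← hδdef] at hacc
  have h4 : 2 / ((K : ℝ) - 1) * ∑ b ∈ Finset.univ.erase a,
      X.P.real (X.crossing b (-1) fun n => (γ / 2) * √(n : ℝ)) ≤ 6 * δ := by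
    -- Since $\delta\le1/2$, this boundary lies above the one with slope $\delta\gamma$, whose
    -- crossing probability is already known.
    have e1 : ∀ b, X.P.real (X.crossing b (-1) fun n => (γ / 2) * √(n : ℝ)) ≤ 3 * δ := by
      intro b
      have e2 := X.prob_crossing_accuracy_le hT hγ hγ2 b (s := -1) (by norm_num)
      have e3 : 3 / Real.log T = 3 * (1 / Real.log T) := by ring
      refine (measureReal_mono ?_).trans (e2.trans (by rw [e3]; linarith))
      rintro ω ⟨t, ht, hn, hle⟩
      refine ⟨t, ht, hn, le_trans ?_ hle⟩
      simp only
      rw [← hδdef]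
      refine mul_le_mul_of_nonneg_right ?_ (Real.sqrt_nonneg _)
      nlinarith
    calc _ ≤ 2 / ((K : ℝ) - 1) * ∑ _b ∈ Finset.univ.erase a, 3 * δ :=
          mul_le_mul_of_nonneg_left (Finset.sum_le_sum fun b _ => e1 b) (by positivity)
      _ = 6 * δ := by
          rw [Finset.sum_const, Finset.card_erase_of_mem (Finset.mem_univ _), Finset.card_univ,
            Fintype.card_fin, nsmul_eq_mul, Nat.cast_sub (by omega), Nat.cast_one]
          field_simp
          norm_num
  have hg : 0 < γ ^ 2 / d ^ 2 := by positivity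
  have hr0 : 0 < 1 / (1 + 1 / (3 * L)) ^ 2 := by positivity
  have hr1 : 1 / (1 + 1 / (3 * L)) ^ 2 ≤ 1 := by
    have : 0 < 1 / (3 * L) := by positivity
    rw [div_le_one (by positivity)]
    nlinarith
  have e1 : m₁ = γ ^ 2 / d ^ 2 * ((1 + δ) ^ 2 * (1 / (1 + 1 / (3 * L)) ^ 2)) := by
    rw [hm₁, hD]; field_simp
  have e2 : γ ^ 2 / D ^ 2 * δ = γ ^ 2 / d ^ 2 * (δ * (1 / (1 + 1 / (3 * L)) ^ 2)) := by
    rw [hD]; field_simp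
  have e3 : m₂ = γ ^ 2 / d ^ 2 * (4 * (1 + δ) ^ 2) := by
    rw [hm₂]; field_simp; norm_num
  have e4 : γ ^ 2 / (d / 2) ^ 2 * δ = γ ^ 2 / d ^ 2 * (4 * δ) := by
    field_simp; norm_num
  have e5 : 2 / (γ * (d / 2)) ^ 2 ≤ γ ^ 2 / d ^ 2 * δ := by
    have : 2 / (γ * (d / 2)) ^ 2 = γ ^ 2 / d ^ 2 * (2 / Real.log T * (1 / Real.log T)) := by
      rw [mul_pow, hγ2]; field_simp
    rw [this]
    refine mul_le_mul_of_nonneg_left (le_trans ?_ hacc) hg.le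
    refine mul_le_of_le_one_left (by positivity) ?_
    rw [div_le_one (by linarith)]; linarith
  -- The additive 1, expressed in units of the Lai–Robbins count; here the gap is known exactly.
  have e6 : (1 : ℝ) = γ ^ 2 / d ^ 2 * (L ^ 2 * (K / T) / 2) := by
    rw [haL, mul_pow, Real.sq_sqrt (by positivity), hγ2]; field_simp
  have e7 : m₂ * (2 / ((K : ℝ) - 1) * ∑ b ∈ Finset.univ.erase a,
      X.P.real (X.crossing b (-1) fun n => (γ / 2) * √(n : ℝ))) ≤
      γ ^ 2 / d ^ 2 * (4 * (1 + δ) ^ 2 * (6 * δ)) := by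
    rw [e3, mul_assoc]
    refine mul_le_mul_of_nonneg_left ?_ hg.le
    exact mul_le_mul_of_nonneg_left h4 (by positivity)
  rw [e2] at h1
  rw [e4] at h2
  generalize 1 / (1 + 1 / (3 * L)) ^ 2 = r at *
  have hfin := sum_errors_le hδ0 hδ1 hr1 hr0.le (show 0 ≤ L ^ 2 * ((K : ℝ) / T) by positivity)
  have hfin' := mul_le_mul_of_nonneg_left hfin hg.le
  have hm : γ ^ 2 / d ^ 2 * (L ^ 2 * (K / T) / 2) + m₁ +
      γ ^ 2 / d ^ 2 * (δ * r) + γ ^ 2 / d ^ 2 * (4 * (1 + δ) ^ 2 * (6 * δ)) +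
      γ ^ 2 / d ^ 2 * (4 * δ) + γ ^ 2 / d ^ 2 * δ ≤
      γ ^ 2 / d ^ 2 * (r + 70 * δ + L ^ 2 * (K / T)) := by
    rw [e1]
    refine le_trans (le_of_eq ?_) hfin'
    generalize γ ^ 2 / d ^ 2 = g
    ring
  refine le_trans ?_ hm
  rw [← e6]
  linarith

end UCB1Run

/-- A run in the class `gapClass T K σ η L` whose ratio of regrets is bounded away from one. -/
theorem exists_run_ratio_le {T K : ℕ} {σ η L : ℝ} (hK : 2 ≤ K) (hKT : K ≤ T)
    (hT : Real.exp 100 ≤ T) (hσ : 0 < σ) (hL : 0 < L) (hη : L * √((K : ℝ) / T) ≤ η) :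
    ∃ Δ ∈ gapClass T K σ η L, ∃ μ : Fin K → ℝ, gap μ = Δ ∧
      ∃ X : UCB1Run.{u} T K μ σ (√(2 * Real.log T)), X.regret / laiRobbins T σ Δ ≤
        1 / (1 + 1 / (3 * L)) ^ 2 + 70 * accuracy T + L ^ 2 * (K / T) := by
  have hℓ := hundred_le_log hT
  have hT' : (0 : ℝ) < T := (Real.exp_pos _).trans_le hT
  have hK' : (2 : ℝ) ≤ K := by exact_mod_cast hK
  set D := σ * (L * √(K * Real.log T / T)) with hD
  have hD0 : 0 < D := by positivity
  have hDσ : D / σ = L * √(K * Real.log T / T) := by rw [hD]; field_simp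
  have : NeZero K := ⟨by omega⟩
  set z : Fin K := 0
  set o : Fin K := ⟨1, by omega⟩ with ho
  have hoz : o ≠ z := fun h => by simpa [o, z] using congrArg Fin.val h
  -- The mirror image of the vector in `exists_small_ratio`: one suboptimal arm, all others optimal.
  set Δ : Fin K → ℝ := fun a => if a = z then D else 0 with hΔ
  have hΔ0 : ∀ a, 0 ≤ Δ a := fun a => by simp only [hΔ]; split_ifs <;> linarith
  have hgap : gap (fun a => -Δ a) = Δ := by
    have hopt : optMean (fun a => -Δ a) = 0 := by
      refine le_antisymm (ciSup_le fun a => neg_nonpos.mpr (hΔ0 a)) ?_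
      refine le_ciSup_of_le (Set.finite_range _).bddAbove o ?_
      simp [hΔ, hoz]
    funext a
    rw [gap, hopt]; ring
  have hz : Δ z = D := by simp [hΔ]
  obtain ⟨X⟩ := nonempty_ucb1Run.{u} (T := T) (by omega : 0 < K) (fun a => -Δ a) σ
    (√(2 * Real.log T))
  refine ⟨Δ, ⟨hΔ0, ?_, ?_, fun a ha => ?_⟩, _, hgap, X, ?_⟩
  · rw [Set.ssubset_univ_iff, Set.ne_univ_iff_exists_notMem]
    exact ⟨o, by simp [hΔ, hoz]⟩
  · exact Function.ne_iff.mpr ⟨z, by rw [hz]; exact hD0.ne'⟩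
  · have haz : a = z := by
      by_contra h
      simp [hΔ, h] at ha
    rw [haz, hz, hDσ]
    refine ⟨le_rfl, ?_⟩
    have : √(K * Real.log T / T) = √((K : ℝ) / T) * √(Real.log T) := by
      rw [← Real.sqrt_mul (by positivity)]; congr 1; ring
    rw [this, ← mul_assoc]
    exact mul_le_mul_of_nonneg_right hη (Real.sqrt_nonneg _)
  · have h := X.ratio_le (a := z) (r := 1 / (1 + 1 / (3 * L)) ^ 2 + 70 * accuracy T +
        L ^ 2 * (K / T)) (by linarith) hσ (sqrt_two_mul_sq (by linarith))
      (by rw [hgap, hz]; exact hD0) fun c hc => ?_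
    · rwa [hgap] at h
    · have hcz : c = z := by
        by_contra h
        rw [hgap] at hc
        simp [hΔ, h] at hc
      subst hcz
      refine X.integral_count_le_of_many_optimal hK hKT hT hσ (Real.sqrt_pos.mpr (by linarith))
        (sqrt_two_mul_sq (by linarith)) hL (fun b hb => ?_) ?_
      · rw [hgap]; simp [hΔ, hb]
      · rw [hgap, hz, hDσ]

end Bandit

/-! ### Sequences of problems: uniform exactness and the growth of `L`. -/

namespace Bandit

theorem LaiRobbinsWithin.mono {T K : ℕ} {σ η L δ δ' : ℝ}
    (h : LaiRobbinsWithin.{u} T K σ η L δ) (hδ : δ ≤ δ') : LaiRobbinsWithin.{u} T K σ η L δ' :=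
  fun Δ hΔ μ hμ X => (h Δ hΔ μ hμ X).trans hδ

theorem tendsto_sqrt_log_log_div_log {T : ℕ → ℕ}
    (hT : Filter.Tendsto T Filter.atTop Filter.atTop) :
    Filter.Tendsto (fun n => √(Real.log (Real.log (T n)) / Real.log (T n)))
      Filter.atTop (nhds 0) := by
  have h1 : Filter.Tendsto (fun n => Real.log (T n)) Filter.atTop Filter.atTop :=
    Real.tendsto_log_atTop.comp (tendsto_natCast_atTop_atTop.comp hT)
  have h2 := Real.tendsto_pow_log_div_mul_add_atTop 1 0 1 one_ne_zero
  simp only [one_mul, add_zero, pow_one] at h2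
  have h3 := (Real.continuous_sqrt.tendsto 0).comp (h2.comp h1)
  rwa [Real.sqrt_zero] at h3

section Sequences

variable {T K : ℕ → ℕ} {σ η L : ℕ → ℝ} (hK : ∀ n, 2 ≤ K n) (hσ : ∀ n, 0 < σ n)
  (hL : ∀ n, 0 < L n) (hη : ∀ n, L n * √((K n : ℝ) / T n) ≤ η n)
  (hT : Filter.Tendsto T Filter.atTop Filter.atTop)
  (hKT : Filter.Tendsto (fun n => (K n : ℝ) / T n) Filter.atTop (nhds 0))
include hK hσ hL hη hT hKT

theorem eventually_within_of_tendsto (hη0 : Filter.Tendsto η Filter.atTop (nhds 0))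
    (hLT : Filter.Tendsto L Filter.atTop Filter.atTop) {δ : ℝ} (hδ : 0 < δ) :
    ∀ᶠ n in Filter.atTop, LaiRobbinsWithin.{u} (T n) (K n) (σ n) (η n) (L n) δ := by
  have hlim : Filter.Tendsto (fun n => Real.exp 100 *
      (1 / L n + (√(Real.log (Real.log (T n)) / Real.log (T n)) + (K n : ℝ) / T n) + η n))
      Filter.atTop (nhds 0) := by
    have h := (((tendsto_const_nhds (x := (1 : ℝ))).div_atTop hLT).add
      ((tendsto_sqrt_log_log_div_log hT).add hKT)).add hη0 |>.const_mul (Real.exp 100)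
    simpa using h
  filter_upwards [hlim.eventually_lt_const hδ, hLT.eventually_gt_atTop (Real.exp 100),
    hη0.eventually_lt_const one_pos, hT.eventually_gt_atTop 0,
    hKT.eventually_lt_const (show (0 : ℝ) < 1 / Real.exp 100 by positivity)]
    with n h1 h2 h3 h4 h5
  refine (laiRobbinsWithin_of_large_gaps h4 (hσ n) ?_ h3.le h5.le h2).mono h1.le
  have hKn := hK n
  have : (0 : ℝ) < (K n : ℝ) / T n :=
    div_pos (Nat.cast_pos.mpr (by omega)) (Nat.cast_pos.mpr h4)
  exact lt_of_lt_of_le (mul_pos (hL n) (Real.sqrt_pos.mpr this)) (hη n)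

/-- If `L` stayed below `B` infinitely often, the bound of `exists_run_ratio_le`, increasing in `L`,
would keep some ratio below a constant less than one along those indices. -/
theorem tendsto_of_eventually_within
    (h : ∀ δ : ℝ, 0 < δ → ∀ᶠ n in Filter.atTop,
      LaiRobbinsWithin.{u} (T n) (K n) (σ n) (η n) (L n) δ) :
    Filter.Tendsto L Filter.atTop Filter.atTop := by
  refine Filter.tendsto_atTop.mpr fun B' => ?_
  set B := max B' 1 with hB
  have hB0 : 0 < B := lt_of_lt_of_le one_pos (le_max_right _ _)
  set r := 1 / (1 + 1 / (3 * B)) ^ 2 with hr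
  have hr1 : r < 1 := by
    have : 0 < 1 / (3 * B) := by positivity
    rw [hr, div_lt_one (by positivity)]
    nlinarith
  have hlim : Filter.Tendsto (fun n => 70 * accuracy (T n) + B ^ 2 * ((K n : ℝ) / T n))
      Filter.atTop (nhds 0) := by
    have h := ((tendsto_sqrt_log_log_div_log hT).const_mul 2 |>.const_mul 70).add
      (hKT.const_mul (B ^ 2))
    simpa [accuracy] using h
  -- Half of the distance from `r` to 1 is the tolerance of the hypothesis; the other half absorbs
  -- the vanishing errors.
  have hδ : 0 < (1 - r) / 2 := by linarith
  filter_upwards [h _ hδ, hlim.eventually_lt_const hδ,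
    (tendsto_natCast_atTop_atTop.comp hT).eventually_ge_atTop (Real.exp 100),
    hT.eventually_gt_atTop 0, hKT.eventually_lt_const one_pos] with n h1 h2 h3 h4 h5
  by_contra hlt
  rw [not_le] at hlt
  have hLB : L n ≤ B := hlt.le.trans (le_max_left _ _)
  have hLn := hL n
  have hKT' : K n ≤ T n := by
    rw [div_lt_one (Nat.cast_pos.mpr h4)] at h5
    exact_mod_cast h5.le
  obtain ⟨Δ, hΔ, μ, hμ, X, hX⟩ :=
    exists_run_ratio_le.{u} (hK n) hKT' h3 (hσ n) hLn (hη n)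
  have h6 := (abs_le.mp (h1 Δ hΔ μ hμ X)).1
  have h7 : 1 / (1 + 1 / (3 * L n)) ^ 2 ≤ r := by
    rw [hr]; gcongr
  have h8 : L n ^ 2 * ((K n : ℝ) / T n) ≤ B ^ 2 * ((K n : ℝ) / T n) := by gcongr
  linarith

end Sequences

end Bandit

end

theorem mainTheorem5 :
    (∃ C : ℝ, 0 < C ∧ ∀ (T K : ℕ) (σ η : ℝ), 0 < T → 0 < σ → 0 < η → (K : ℝ) / T ≤ 1 / C →
      (η ≤ 1 → ∀ L : ℝ, C < L →
        Bandit.LaiRobbinsWithin.{u} T K σ η L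
          (C * (1 / L + (√(Real.log (Real.log T) / Real.log T) + (K : ℝ) / T) + η))) ∧
      (2 ≤ K → ∀ ε : ℝ, 0 < ε → ε < 1 / 2 → ε * √((K : ℝ) / T) ≤ η →
        ∃ Δ ∈ Bandit.gapClass T K σ η ε, ∀ μ : Fin K → ℝ, Bandit.gap μ = Δ →
          ∀ X : Bandit.UCB1Run.{u} T K μ σ (√(2 * Real.log T)),
            X.regret / Bandit.laiRobbins T σ Δ ≤ C * ε ^ 2)) ∧
    (∀ (T K : ℕ → ℕ) (σ η L : ℕ → ℝ),
      (∀ n, 2 ≤ K n) → (∀ n, 0 < σ n) → (∀ n, 0 < L n) →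
      (∀ n, L n * √((K n : ℝ) / T n) ≤ η n) →
      Filter.Tendsto T Filter.atTop Filter.atTop →
      Filter.Tendsto (fun n => (K n : ℝ) / T n) Filter.atTop (nhds 0) →
      Filter.Tendsto η Filter.atTop (nhds 0) →
      ((∀ δ : ℝ, 0 < δ → ∀ᶠ n in Filter.atTop,
          Bandit.LaiRobbinsWithin.{u} (T n) (K n) (σ n) (η n) (L n) δ) ↔
        Filter.Tendsto L Filter.atTop Filter.atTop)) := by
  refine ⟨⟨Real.exp 100, Real.exp_pos _, fun T K σ η hT hσ hη hKT => ⟨fun hη1 L hL =>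
    Bandit.laiRobbinsWithin_of_large_gaps hT hσ hη hη1 hKT hL, fun hK ε hε _ hεη => ?_⟩⟩,
    fun T K σ η L hK hσ hL hη hT hKT hη0 =>
      ⟨Bandit.tendsto_of_eventually_within hK hσ hL hη hT hKT, fun hLT δ hδ =>
        Bandit.eventually_within_of_tendsto hK hσ hL hη hT hKT hη0 hLT hδ⟩⟩
  obtain ⟨Δ, hΔ, h⟩ := Bandit.exists_small_ratio.{u} hT hσ hKT hK hε hεη
  refine ⟨Δ, hΔ, fun μ hμ X => (h μ hμ X).trans ?_⟩
  exact le_mul_of_one_le_left (sq_nonneg ε) (by linarith [Bandit.exp_hundred_ge])
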